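/- Let $C$ be the complex projective curve $y^2=x^5-1$, with its unique point $\infty$ at infinity. For points $(x,y)\neq\infty$ of $C$ near $\infty$ put $$u_1=\int_\infty^{(x,y)}\frac{dx}{2y},\qquad u_2=\int_\infty^{(x,y)}\frac{x\,dx}{2y},$$ the integrals being taken along paths that stay in the neighbourhood $\{|x|>1\}\cup\{\infty\}$ of $\infty$. Near $(0,0)$ the map $(x,y)\mapsto(u_1,u_2)$ has an inverse $u=(u_1,u_2)\mapsto(x(u),y(u))$, defined on the set of values $(u_1,u_2)$. For $u\neq(0,0)$ in this set and sufficiently close to $(0,0)$ one has $u_2\ne 0$ and $x(u)$, $y(u)$ have Laurent expansions in $u_2$ of the form $$x(u)=\frac1{u_2^{2}}+\sum_{n=1}^\infty\frac{C_{10n}}{10n}\,\frac{u_2^{10n-2}}{(10n-2)!},\qquad y(u)=\frac{-1}{u_2^{5}}+\sum_{n=1}^\infty\frac{D_{10n}}{10n}\,\frac{u_2^{10n-5}}{(10n-5)!},$$ which define the numbers $C_{10n}$ and $D_{10n}$. Then for every $n\ge 1$ there exist integers $G_{10n}$ and $H_{10n}$ such that $$C_{10n}=\sum_{\substack{p\equiv1\bmod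 5\\ (p-1)\mid 10n}}\frac{A_p^{10n/(p-1)}}{p}+G_{10n},\qquad D_{10n}=\sum_{\substack{p\equiv1\bmod 5\\ (p-1)\mid 10n}}\frac{(4!^{-1}\bmod p)\,A_p^{10n/(p-1)}}{p}+H_{10n}.$$ Here $p$ runs over prime numbers, $4!^{-1}\bmod p$ is the integer in $[0,p)$ that is inverse to $4!$ modulo $p$, and $$A_p=(-1)^{(p-1)/10}\binom{(p-1)/2}{(p-1)/10}.$$ -/

import Mathlib

open Filter Topology

/-- The affine part of the curve `y ^ 2 = x ^ 5 - 1` over `ℂ`. Its projective completion has a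
single further point `∞`, and an affine point is close to `∞` when `x` is large. -/
def quinticCurve : Set (ℂ × ℂ) :=
  {P | P.2 ^ 2 = P.1 ^ 5 - 1}

/-- A continuously differentiable path `t ↦ (x t, y t)`, `0 < t ≤ 1`, on the curve
`y ^ 2 = x ^ 5 - 1` which starts at `∞` (as `t → 0`), ends at the point `P` (at `t = 1`), and stays
in the neighbourhood `{1 < |x|} ∪ {∞}` of `∞`. This neighbourhood is a disc (all finite
branch points have `|x| = 1`), so that integrals of holomorphic differentials along
such a path depend only on the end point `P`. -/
structure IsPathFromInfinity (x y : ℝ → ℂ) (P : ℂ × ℂ) : Prop where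
  contDiffOn_x : ContDiffOn ℝ 1 x (Set.Ioc 0 1)
  contDiffOn_y : ContDiffOn ℝ 1 y (Set.Ioc 0 1)
  mem_curve : ∀ t ∈ Set.Ioc (0 : ℝ) 1, (x t, y t) ∈ quinticCurve
  one_lt_norm : ∀ t ∈ Set.Ioc (0 : ℝ) 1, 1 < ‖x t‖
  start_at_infinity : Tendsto (fun t => ‖x t‖) (𝓝[>] 0) atTop
  end_at : (x 1, y 1) = P

/-- `u = (u₁, u₂)` is the value at the point `P` of the pair of (improper) integrals
`u₁ = ∫_∞^P dx / (2 y)` and `u₂ = ∫_∞^P x dx / (2 y)`, taken near `∞`. -/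
def IsAbelianIntegral (P u : ℂ × ℂ) : Prop :=
  ∃ x y : ℝ → ℂ, IsPathFromInfinity x y P ∧
    Tendsto (fun ε : ℝ => ∫ t in ε..1, deriv x t / (2 * y t)) (𝓝[>] 0) (𝓝 u.1) ∧
    Tendsto (fun ε : ℝ => ∫ t in ε..1, x t * deriv x t / (2 * y t)) (𝓝[>] 0) (𝓝 u.2)

/-- The set of all values `(u₁, u₂)` of the integrals from `∞` to points near `∞`. -/
def abelianRange : Set (ℂ × ℂ) :=
  {u | ∃ P, IsAbelianIntegral P u}

/-- The functions `x(u₁, u₂)`, `y(u₁, u₂)` on the range of values of the integrals invert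
`(x, y) ↦ (u₁, u₂)` in a neighbourhood of `(0, 0)`. -/
def IsAbelianInverse (x y : ℂ × ℂ → ℂ) : Prop :=
  ∀ᶠ u in 𝓝[abelianRange] (0, 0), ∀ P, IsAbelianIntegral P u → (x u, y u) = P

/-- The numbers `C_{10n}`, `D_{10n}`, `n ≥ 1`, (the other entries of `C`, `D` play no role) are the
normalised Laurent coefficients of `x(u)`, `y(u)` in the variable `u₂`: near `(0, 0)`,
`x(u) = 1 / u₂ ^ 2 + ∑_{n ≥ 1} C_{10n} / (10n) * u₂ ^ (10n - 2) / (10n - 2)!` and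
`y(u) = -1 / u₂ ^ 5 + ∑_{n ≥ 1} D_{10n} / (10n) * u₂ ^ (10n - 5) / (10n - 5)!`.
The summation index `k` below is `n - 1`. -/
def AreLaurentCoefficients (x y : ℂ × ℂ → ℂ) (C D : ℕ → ℂ) : Prop :=
  ∀ᶠ u in 𝓝[abelianRange] (0, 0),
    u.2 ≠ 0 ∧
    HasSum (fun k : ℕ => C (10 * (k + 1)) / ((10 * (k + 1) : ℕ) : ℂ) *
        (u.2 ^ (10 * (k + 1) - 2) / (Nat.factorial (10 * (k + 1) - 2) : ℂ)))
      (x u - 1 / u.2 ^ 2) ∧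
    HasSum (fun k : ℕ => D (10 * (k + 1)) / ((10 * (k + 1) : ℕ) : ℂ) *
        (u.2 ^ (10 * (k + 1) - 5) / (Nat.factorial (10 * (k + 1) - 5) : ℂ)))
      (y u - (-1) / u.2 ^ 5)

/-- `A_p = (-1) ^ ((p - 1) / 10) * binom ((p - 1) / 2) ((p - 1) / 10)`, used for primes
`p ≡ 1 mod 5`, for which both quotients are exact. -/
def hasseA (p : ℕ) : ℤ :=
  (-1) ^ ((p - 1) / 10) * (Nat.choose ((p - 1) / 2) ((p - 1) / 10) : ℤ)

/-- The primes `p ≡ 1 mod 5` such that `p - 1` divides `m` (for `m ≥ 1`). -/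
def clausenPrimes (m : ℕ) : Finset ℕ :=
  (Finset.range (m + 2)).filter (fun p => p.Prime ∧ p ≡ 1 [MOD 5] ∧ (p - 1) ∣ m)

theorem mem_clausenPrimes {m : ℕ} (hm : 1 ≤ m) (p : ℕ) :
    p ∈ clausenPrimes m ↔ p.Prime ∧ p ≡ 1 [MOD 5] ∧ (p - 1) ∣ m := by
  simp only [clausenPrimes, Finset.mem_filter, Finset.mem_range, and_iff_right_iff_imp]
  rintro ⟨-, -, h⟩
  have := Nat.le_of_dvd hm h
  omega

/-- The residue `4!⁻¹ mod p`, as an integer in `[0, p)`. -/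
def invFactorialFour (p : ℕ) : ℕ :=
  ((Nat.factorial 4 : ZMod p)⁻¹).val

/-! With the local parameter s = x^(-1/2) at infinity, signed so that y = -√(1 - s^10) / s^5, the
differentials become du₁ = s² ds/√(1 - s^10) and du₂ = ds/√(1 - s^10). Hence u₂ = s·G(s^10) with G =
1 + L, where L = ∑ a_k X^k/(10k + 1) over k ≥ 1 and a_k = binom(2k, k)/4^k. As u₂² x = (u₂/s)² and
u₂^5 y = -√(1 - s^10)·(u₂/s)^5, Lagrange inversion (`coeff_taylorSeries_eq`) turns C_N/2 and D_N,
with N = 10n, into -N·(N - r)!·[X^n] G^(-(N - r + 1)) for r = 3 and r = 5: this is `laurentNumber`.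

For the arithmetic, the negative power is expanded in powers of L. The coefficients of L^e/e!,
multiplied by factorials, count permutations with e cycles of lengths 10k + 1, weighted by the a_k.
The factor N allows one cycle to be marked with weight 10k (`laurentNumber_eq_sum`). The terms are
p-integral unless the marked length 10k + 1 equals p (`cycleTerm_mem`), and even then unless every
cycle has length p (`cycleTerm_sub_mem`). The prime 2, which divides the denominators of the a_k, is
treated separately. So a pole occurs only at primes p = 10j + 1 with j ∣ n. There the surviving term
is evaluated by Wilson's theorem and a_j ≡ A_p mod p (`mainCycleTerm_sub_mem`): (r - 1)! times it is
A_p^(n/j)/p up to a p-integral error. For C the factor 2! is present already; for D one divides by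
4!. A rational number integral at all primes is an integer, which gives G and H.

For the analysis, Re(du₂/ds) ≥ 1/2 on the whole disc |s| < 1, so u₂ is injective there and small u₂
forces small s. Statements near (0, 0) on the range of the integrals are therefore statements about
small nonzero s (`eventually_abelianRange_iff`). -/

/-! ### Integrality at a prime -/

/-- The rational numbers that are integral at the prime `p`. -/
def integralAt (p : ℕ) [hp : Fact p.Prime] : Subring ℚ where
  carrier := {q | ∃ d : ℕ, ¬ p ∣ d ∧ ∃ z : ℤ, q * d = z}
  mul_mem' := by
    rintro a b ⟨d, hd, z, hz⟩ ⟨d', hd', z', hz'⟩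
    refine ⟨d * d', fun h => ?_, z * z', ?_⟩
    · exact (hp.out.dvd_mul.1 h).elim hd hd'
    · push_cast
      rw [← hz, ← hz']
      ring
  add_mem' := by
    rintro a b ⟨d, hd, z, hz⟩ ⟨d', hd', z', hz'⟩
    refine ⟨d * d', fun h => ?_, z * d' + z' * d, ?_⟩
    · exact (hp.out.dvd_mul.1 h).elim hd hd'
    · push_cast
      rw [← hz, ← hz']
      ring
  one_mem' := ⟨1, hp.out.one_lt.ne' ∘ Nat.dvd_one.1, 1, by simp⟩
  zero_mem' := ⟨1, hp.out.one_lt.ne' ∘ Nat.dvd_one.1, 0, by simp⟩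
  neg_mem' := by
    rintro a ⟨d, hd, z, hz⟩
    exact ⟨d, hd, -z, by push_cast; rw [← hz]; ring⟩

theorem inv_natCast_mem_integralAt {p : ℕ} [Fact p.Prime] {d : ℕ} (hd : ¬ p ∣ d) :
    (d : ℚ)⁻¹ ∈ integralAt p := by
  refine ⟨d, hd, 1, ?_⟩
  have : (d : ℚ) ≠ 0 := by
    rintro h
    rw [Nat.cast_eq_zero] at h
    exact hd (h ▸ dvd_zero p)
  simp [this]

theorem exists_int_of_forall_integralAt {q : ℚ}
    (h : ∀ (p : ℕ) [Fact p.Prime], q ∈ integralAt p) : ∃ z : ℤ, q = z := by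
  have hden : q.den = 1 := by
    by_contra hne
    obtain ⟨p, hp, hpd⟩ := Nat.exists_prime_and_dvd hne
    have : Fact p.Prime := ⟨hp⟩
    obtain ⟨d, hd, z, hz⟩ := h p
    have h1 : (q.num : ℚ) * d = z * q.den := by
      rw [← hz]
      nth_rewrite 1 [← Rat.mul_den_eq_num q]
      ring
    have h2 : q.num * d = z * q.den := by exact_mod_cast h1
    have h3 : (q.den : ℤ) ∣ q.num * d := ⟨z, by rw [h2]; ring⟩
    have h4 : IsCoprime (q.den : ℤ) q.num := by
      rw [Int.isCoprime_iff_nat_coprime]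
      simpa using q.reduced.symm
    have h5 : q.den ∣ d := by exact_mod_cast h4.dvd_of_dvd_mul_left h3
    exact hd (hpd.trans h5)
  exact ⟨q.num, by simpa [hden] using (Rat.mul_den_eq_num q)⟩

theorem natCast_div_mem_of_dvd (S : Subring ℚ) {a b : ℕ} (h : b ∣ a) : (a : ℚ) / b ∈ S := by
  rw [← Nat.cast_div_charZero h]
  exact natCast_mem S _

theorem inv_factorial_mem_integralAt {p : ℕ} [hp : Fact p.Prime] {n : ℕ} (hn : n < p) :
    ((n.factorial : ℕ) : ℚ)⁻¹ ∈ integralAt p :=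
  inv_natCast_mem_integralAt fun h => (not_le.2 hn) (hp.out.dvd_factorial.1 h)

/-! ### Coefficients of divided powers of `∑ a k / (10 k + 1) X ^ k` -/

/-- The power series `∑ a k / (10 k + 1) X ^ k`. -/
noncomputable def logSeries (a : ℕ → ℚ) : PowerSeries ℚ :=
  PowerSeries.mk fun k => a k / ((10 * k + 1 : ℕ) : ℚ)

/-- The coefficients of the divided powers of `logSeries a`. -/
noncomputable def divPowCoeff (a : ℕ → ℚ) (e m : ℕ) : ℚ :=
  PowerSeries.coeff m (logSeries a ^ e) / (e.factorial : ℚ)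

theorem divPowCoeff_zero (a : ℕ → ℚ) (m : ℕ) :
    divPowCoeff a 0 m = if m = 0 then 1 else 0 := by
  simp [divPowCoeff, PowerSeries.coeff_one]

-- For ℓ(z) = z·L(z^10) this is the formula ℓ'(z) = ∑ a_k z^(10k), written in X = z^10.
open PowerSeries in
theorem ten_mul_X_mul_derivative_logSeries (a : ℕ → ℚ) :
    10 * X * derivative ℚ (logSeries a) + logSeries a = PowerSeries.mk a := by
  ext n
  have h10 : (10 : PowerSeries ℚ) = PowerSeries.C (10 : ℚ) := (map_ofNat PowerSeries.C 10).symm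
  rw [h10, mul_assoc, map_add, coeff_C_mul]
  cases n with
  | zero => simp [logSeries]
  | succ n =>
    rw [coeff_succ_X_mul, coeff_derivative, logSeries, coeff_mk, coeff_mk]
    have : ((10 * (n + 1) + 1 : ℕ) : ℚ) ≠ 0 := by positivity
    field_simp
    push_cast
    ring

/-- With ℓ(z) = z·L(z^10), the derivative of ℓ^(e+1)/(e+1)! is ℓ'·ℓ^e/e!; these are the coefficients
of z^(10m+e). -/
theorem divPowCoeff_weighted (a : ℕ → ℚ) (e m : ℕ) :
    ((10 * m + e + 1 : ℕ) : ℚ) * divPowCoeff a (e + 1) m =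
      ∑ x ∈ Finset.HasAntidiagonal.antidiagonal m, a x.1 * divPowCoeff a e x.2 := by
  have key : 10 * PowerSeries.X * PowerSeries.derivative ℚ (logSeries a ^ (e + 1)) +
      ((e : PowerSeries ℚ) + 1) * logSeries a ^ (e + 1) =
      ((e : PowerSeries ℚ) + 1) * (PowerSeries.mk a * logSeries a ^ e) := by
    rw [← ten_mul_X_mul_derivative_logSeries a, Derivation.leibniz_pow]
    simp only [smul_eq_mul, nsmul_eq_mul, Nat.add_sub_cancel]
    push_cast
    ring
  have h10 : (10 : PowerSeries ℚ) = PowerSeries.C (10 : ℚ) := (map_ofNat PowerSeries.C 10).symm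
  have he : ((e : PowerSeries ℚ) + 1) = PowerSeries.C ((e : ℚ) + 1) := by simp
  have h := congrArg (PowerSeries.coeff m) key
  rw [h10, he, map_add, mul_assoc, PowerSeries.coeff_C_mul, PowerSeries.coeff_C_mul,
    PowerSeries.coeff_C_mul, PowerSeries.coeff_mul m (PowerSeries.mk a)] at h
  have hX : PowerSeries.coeff m (PowerSeries.X *
      PowerSeries.derivative ℚ (logSeries a ^ (e + 1))) =
      m * PowerSeries.coeff m (logSeries a ^ (e + 1)) := by
    cases m with
    | zero => simp
    | succ m =>
      rw [PowerSeries.coeff_succ_X_mul, PowerSeries.coeff_derivative]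
      push_cast
      ring
  rw [hX] at h
  simp only [PowerSeries.coeff_mk] at h
  have hf : (e.factorial : ℚ) ≠ 0 := by positivity
  have he' : (e : ℚ) + 1 ≠ 0 := by positivity
  have hs : ∑ x ∈ Finset.HasAntidiagonal.antidiagonal m, a x.1 * divPowCoeff a e x.2 =
      (∑ x ∈ Finset.HasAntidiagonal.antidiagonal m, a x.1 * PowerSeries.coeff x.2 (logSeries a ^ e)) /
        (e.factorial : ℚ) := by
    rw [Finset.sum_div]
    exact Finset.sum_congr rfl fun x _ => by rw [divPowCoeff, mul_div_assoc]
  rw [hs, divPowCoeff, Nat.factorial_succ]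
  push_cast
  rw [eq_div_iff hf]
  field_simp
  linear_combination h

theorem divPowCoeff_succ (a : ℕ → ℚ) (e m : ℕ) :
    ((e + 1 : ℕ) : ℚ) * divPowCoeff a (e + 1) m =
      ∑ x ∈ Finset.HasAntidiagonal.antidiagonal m,
        a x.1 / ((10 * x.1 + 1 : ℕ) : ℚ) * divPowCoeff a e x.2 := by
  have hf : (e.factorial : ℚ) ≠ 0 := by positivity
  have hs : ∑ x ∈ Finset.HasAntidiagonal.antidiagonal m, a x.1 / ((10 * x.1 + 1 : ℕ) : ℚ) * divPowCoeff a e x.2 =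
      PowerSeries.coeff m (logSeries a ^ (e + 1)) / (e.factorial : ℚ) := by
    rw [pow_succ', PowerSeries.coeff_mul, Finset.sum_div]
    refine Finset.sum_congr rfl fun x _ => ?_
    rw [divPowCoeff, mul_div_assoc, logSeries, PowerSeries.coeff_mk]
  rw [hs, divPowCoeff, Nat.factorial_succ]
  have he' : (e : ℚ) + 1 ≠ 0 := by positivity
  push_cast
  field_simp

/-- Difference of the two preceding recursions. Its gain is the numerator 10k beside the denominator
10k + 1: it removes k = 0 and is -1 modulo a prime 10k + 1. -/
theorem ten_mul_divPowCoeff_succ (a : ℕ → ℚ) (e m : ℕ) :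
    ((10 * m : ℕ) : ℚ) * divPowCoeff a (e + 1) m =
      ∑ x ∈ Finset.HasAntidiagonal.antidiagonal m,
        ((10 * x.1 : ℕ) : ℚ) * a x.1 / ((10 * x.1 + 1 : ℕ) : ℚ) * divPowCoeff a e x.2 := by
  have h1 := divPowCoeff_weighted a e m
  have h2 := divPowCoeff_succ a e m
  have : ((10 * m : ℕ) : ℚ) = ((10 * m + e + 1 : ℕ) : ℚ) - ((e + 1 : ℕ) : ℚ) := by
    push_cast
    ring
  rw [this, sub_mul, h1, h2, ← Finset.sum_sub_distrib]
  refine Finset.sum_congr rfl fun x _ => ?_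
  have : ((10 * x.1 + 1 : ℕ) : ℚ) ≠ 0 := by positivity
  field_simp
  push_cast
  ring

/-! ### Weighted permutations with cycle lengths `10 k + 1` -/

/-- The weighted number of permutations with `e` cycles, whose lengths are of the form `10 k + 1`,
on `10 m + e` letters. -/
noncomputable def cycleSum (a : ℕ → ℚ) (e m : ℕ) : ℚ :=
  ((10 * m + e).factorial : ℚ) * divPowCoeff a e m

theorem cycleSum_zero (a : ℕ → ℚ) (m : ℕ) : cycleSum a 0 m = if m = 0 then 1 else 0 := by
  rw [cycleSum, divPowCoeff_zero]
  split_ifs with h <;> simp [h]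

/-- Remove the cycle through a fixed letter: the quotient of factorials counts the ordered choices
of its other letters. No division remains, so integrality of the weights passes to the sums. -/
theorem cycleSum_succ (a : ℕ → ℚ) (e m : ℕ) :
    cycleSum a (e + 1) m = ∑ x ∈ Finset.HasAntidiagonal.antidiagonal m,
      a x.1 * (((10 * m + e).factorial : ℚ) / ((10 * x.2 + e).factorial : ℚ)) *
        cycleSum a e x.2 := by
  rw [cycleSum, ← add_assoc, Nat.factorial_succ, Nat.cast_mul, mul_comm (Nat.cast (_ + 1)),
    mul_assoc, divPowCoeff_weighted, Finset.mul_sum]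
  refine Finset.sum_congr rfl fun x _ => ?_
  rw [cycleSum]
  have : ((10 * x.2 + e).factorial : ℚ) ≠ 0 := by positivity
  field_simp

theorem cycleSum_mem (S : Subring ℚ) {a : ℕ → ℚ} (ha : ∀ k, a k ∈ S) (e m : ℕ) :
    cycleSum a e m ∈ S := by
  induction e generalizing m with
  | zero =>
    rw [cycleSum_zero]
    split_ifs
    exacts [S.one_mem, S.zero_mem]
  | succ e ih =>
    rw [cycleSum_succ]
    refine S.sum_mem fun x hx => S.mul_mem (S.mul_mem (ha _) ?_) (ih _)
    rw [Finset.HasAntidiagonal.mem_antidiagonal] at hx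
    exact natCast_div_mem_of_dvd S (Nat.factorial_dvd_factorial (by omega))

theorem cycleSum_succ_zero {a : ℕ → ℚ} (ha0 : a 0 = 0) (e : ℕ) : cycleSum a (e + 1) 0 = 0 := by
  rw [cycleSum_succ]
  simp [ha0]

theorem factorial_div_factorial_div_mem (S : Subring ℚ) {p a b : ℕ} (hp : 0 < p) (hb : b < p)
    (ha : p ≤ a) :
    (a.factorial : ℚ) / (b.factorial : ℚ) / (p : ℚ) ∈ S := by
  rw [div_div, ← Nat.cast_mul]
  refine natCast_div_mem_of_dvd S ?_
  refine dvd_trans ?_ (Nat.factorial_dvd_factorial ha)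
  obtain ⟨p, rfl⟩ : ∃ k, p = k + 1 := ⟨p - 1, by omega⟩
  rw [Nat.factorial_succ, mul_comm]
  exact Nat.mul_dvd_mul_left _ (Nat.factorial_dvd_factorial (by omega))

/-- If no cycle has length `p`, then the weighted number of permutations is divisible by `p` when
there are at least `p` letters. -/
theorem cycleSum_div_mem {p : ℕ} [hp : Fact p.Prime] {a : ℕ → ℚ} (ha : ∀ k, a k ∈ integralAt p)
    (ha0 : a 0 = 0) (hap : ∀ k, 10 * k + 1 = p → a k = 0) (e m : ℕ) (h : p ≤ 10 * m + e) :
    cycleSum a e m / p ∈ integralAt p := by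
  have hp2 := hp.out.two_le
  induction e generalizing m with
  | zero =>
    rw [cycleSum_zero, if_neg (by omega)]
    simp
  | succ e ih =>
    -- With exactly p letters, p! / p = (p - 1)! and the divided-power coefficient is itself
    -- p-integral: the number of cycles and all lengths that contribute are below p. With more
    -- letters, the cycle through a fixed letter is removed.
    rcases h.eq_or_lt with h | h
    · have hfac : ((10 * m + (e + 1)).factorial : ℚ) = p * ((p - 1).factorial : ℚ) := by
        rw [← h, ← Nat.cast_mul, Nat.mul_factorial_pred hp.out.ne_zero]
      have hp0 : (p : ℚ) ≠ 0 := by exact_mod_cast hp.out.ne_zero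
      have : cycleSum a (e + 1) m / p =
          ((p - 1).factorial : ℚ) * divPowCoeff a (e + 1) m := by
        rw [cycleSum, hfac]
        field_simp
      rw [this]
      refine Subring.mul_mem _ (natCast_mem _ _) ?_
      rcases Nat.eq_zero_or_pos m with rfl | hm
      · have := cycleSum_succ_zero ha0 e
        rw [cycleSum, mul_eq_zero] at this
        rw [this.resolve_left (by positivity)]
        exact Subring.zero_mem _
      have he : divPowCoeff a (e + 1) m = ((e + 1 : ℕ) : ℚ)⁻¹ *
          ∑ x ∈ Finset.HasAntidiagonal.antidiagonal m,
            a x.1 / ((10 * x.1 + 1 : ℕ) : ℚ) * divPowCoeff a e x.2 := by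
        rw [← divPowCoeff_succ, ← mul_assoc, inv_mul_cancel₀ (by positivity), one_mul]
      rw [he]
      refine Subring.mul_mem _ (inv_natCast_mem_integralAt fun hd => ?_)
        (Subring.sum_mem _ fun x hx => ?_)
      · have := Nat.le_of_dvd (by omega) hd
        omega
      · rw [Finset.HasAntidiagonal.mem_antidiagonal] at hx
        by_cases hx1 : 10 * x.1 + 1 = p
        · rw [hap _ hx1]
          simp
        rcases Nat.eq_zero_or_pos x.1 with hx0 | hx0
        · rw [hx0, ha0]
          simp
        refine Subring.mul_mem _ (Subring.mul_mem _ (ha _)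
          (inv_natCast_mem_integralAt fun hd => ?_)) ?_
        · have := Nat.le_of_dvd (by omega) hd
          omega
        · have hq : divPowCoeff a e x.2 =
              (((10 * x.2 + e).factorial : ℕ) : ℚ)⁻¹ * cycleSum a e x.2 := by
            rw [cycleSum, ← mul_assoc, inv_mul_cancel₀ (by positivity), one_mul]
          rw [hq]
          exact Subring.mul_mem _ (inv_factorial_mem_integralAt (by omega)) (cycleSum_mem _ ha _ _)
    · rw [cycleSum_succ, Finset.sum_div]
      refine Subring.sum_mem _ fun x hx => ?_
      rw [Finset.HasAntidiagonal.mem_antidiagonal] at hx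
      rcases le_or_gt p (10 * x.2 + e) with hT | hT
      · rw [mul_div_assoc]
        exact Subring.mul_mem _ (Subring.mul_mem _ (ha _) (natCast_div_mem_of_dvd _
          (Nat.factorial_dvd_factorial (by omega)))) (ih _ hT)
      -- Fewer than p letters remain, so the quotient of factorials contains the factor p.
      · have : a x.1 * (((10 * m + e).factorial : ℚ) / ((10 * x.2 + e).factorial : ℚ)) *
            cycleSum a e x.2 / p =
            a x.1 * (((10 * m + e).factorial : ℚ) / ((10 * x.2 + e).factorial : ℚ) / p) *
            cycleSum a e x.2 := by ring
        rw [this]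
        exact Subring.mul_mem _ (Subring.mul_mem _ (ha _)
          (factorial_div_factorial_div_mem _ hp.out.pos hT (by omega))) (cycleSum_mem _ ha _ _)

/-! ### Factorials divisible by a cycle length -/

/-- Write w = ab with a, b ≥ 3. Distinct a and b are both factors of (w - r)!; if a = b, then a and
2a are. The lower bound excludes w = 9, which does not divide 4!; it costs nothing, since 21 is the
least composite 10k + 1 with k ≥ 1. -/
theorem dvd_factorial_sub_of_not_prime {w r : ℕ} (hr : r ≤ 5) (hw : 21 ≤ w) (hodd : w % 2 = 1)
    (hnp : ¬ w.Prime) : w ∣ (w - r).factorial := by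
  obtain ⟨a, hadvd, ha2, haw⟩ := Nat.exists_dvd_of_not_prime2 (by omega) hnp
  obtain ⟨b, rfl⟩ := hadvd
  have ha3 : 3 ≤ a := by
    rcases Nat.lt_or_ge a 3 with h | h
    · have : a = 2 := by omega
      subst this
      omega
    · exact h
  have hb2 : 2 ≤ b := by
    rcases Nat.lt_or_ge b 2 with h | h
    · interval_cases b <;> omega
    · exact h
  have hb3 : 3 ≤ b := by
    rcases Nat.lt_or_ge b 3 with h | h
    · have : b = 2 := by omega
      subst this
      omega
    · exact h
  have hlt : ∀ {x y : ℕ}, x < y → y ≤ a * b - r → x ≠ 0 → x * y ∣ (a * b - r).factorial := by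
    intro x y hxy hy hx
    refine dvd_trans ?_ (Nat.factorial_dvd_factorial hy)
    obtain ⟨y, rfl⟩ : ∃ k, y = k + 1 := ⟨y - 1, by omega⟩
    rw [Nat.factorial_succ, mul_comm]
    exact Nat.mul_dvd_mul_left _ (Nat.dvd_factorial (by omega) (by omega))
  have h3b : 3 * b ≤ a * b := Nat.mul_le_mul_right _ ha3
  have h3a : 3 * a ≤ a * b := by rw [mul_comm]; exact Nat.mul_le_mul_left _ hb3
  rcases lt_trichotomy a b with h | h | h
  · exact hlt h (by omega) (by omega)
  · subst h
    have := hlt (x := a) (y := 2 * a) (by omega) (by omega) (by omega)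
    exact dvd_trans (Nat.mul_dvd_mul_left a (Dvd.intro_left 2 rfl)) this
  · rw [mul_comm a b] at *
    exact hlt h (by omega) (by omega)

/-- A prime length other than p is a p-adic unit; a composite length w divides (w - r)!, and (w -
r)!·(T - w)! divides (T - r)!. -/
theorem factorial_div_div_mem {p : ℕ} [hp : Fact p.Prime] {k T r : ℕ} (hr : r ≤ 5) (hk : 1 ≤ k)
    (hkp : 10 * k + 1 ≠ p) (hT : 10 * k + 1 ≤ T) :
    (((T - r).factorial : ℕ) : ℚ) / ((T - (10 * k + 1)).factorial : ℚ) / ((10 * k + 1 : ℕ) : ℚ) ∈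
      integralAt p := by
  by_cases hw : (10 * k + 1).Prime
  · refine Subring.mul_mem _ (natCast_div_mem_of_dvd _ (Nat.factorial_dvd_factorial (by omega)))
      (inv_natCast_mem_integralAt fun h => ?_)
    exact hkp ((Nat.prime_dvd_prime_iff_eq hp.out hw).1 h).symm
  · rw [div_div, ← Nat.cast_mul]
    refine natCast_div_mem_of_dvd _ ?_
    have h1 : 10 * k + 1 ∣ (10 * k + 1 - r).factorial := by
      refine dvd_factorial_sub_of_not_prime hr ?_ (by omega) hw
      rcases hk.eq_or_lt with h | h
      · subst h
        norm_num at hw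
      · omega
    refine (Nat.mul_dvd_mul_left _ h1).trans ?_
    have := Nat.factorial_mul_factorial_dvd_factorial
      (n := T - r) (k := T - (10 * k + 1)) (by omega)
    rwa [show T - r - (T - (10 * k + 1)) = 10 * k + 1 - r by omega] at this
-- Negative powers of `1 + P`
open PowerSeries in
theorem one_add_mul_sum_multichoose (P : PowerSeries ℚ) (m n : ℕ) :
    (1 + P) * ∑ e ∈ Finset.range (n + 1), (-1) ^ e * (Nat.multichoose (m + 1) e : PowerSeries ℚ) *
        P ^ e =
      ∑ e ∈ Finset.range (n + 1), (-1) ^ e * (Nat.multichoose m e : PowerSeries ℚ) * P ^ e +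
        (-1) ^ n * (Nat.multichoose (m + 1) n : PowerSeries ℚ) * P ^ (n + 1) := by
  induction n with
  | zero => simp
  | succ n ih =>
    rw [Finset.sum_range_succ, mul_add, ih, Finset.sum_range_succ _ (n + 1),
      Nat.multichoose_succ_succ]
    push_cast
    ring

/-- The binomial series truncated after P^n differs from the true power by a multiple of P^(n+1),
hence of X^(n+1). -/
theorem coeff_one_add_inv_pow {P : PowerSeries ℚ} (hP : PowerSeries.constantCoeff P = 0)
    (m n : ℕ) :
    PowerSeries.coeff n ((1 + P)⁻¹ ^ m) = ∑ e ∈ Finset.range (n + 1),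
      (-1) ^ e * (Nat.multichoose m e : ℚ) * PowerSeries.coeff n (P ^ e) := by
  have h1 : (1 + P)⁻¹ * (1 + P) = 1 := PowerSeries.inv_mul_cancel _ (by simp [hP])
  have key : ∃ R, ∑ e ∈ Finset.range (n + 1),
      (-1) ^ e * (Nat.multichoose m e : PowerSeries ℚ) * P ^ e =
      (1 + P)⁻¹ ^ m + P ^ (n + 1) * R := by
    induction m with
    | zero =>
      refine ⟨0, ?_⟩
      rw [Finset.sum_range_succ']
      simp [Nat.multichoose_zero_succ]
    | succ m ih =>
      obtain ⟨R, hR⟩ := ih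
      have h := one_add_mul_sum_multichoose P m n
      rw [hR] at h
      refine ⟨(1 + P)⁻¹ * (R + (-1) ^ n * (Nat.multichoose (m + 1) n : PowerSeries ℚ)), ?_⟩
      calc _ = (1 + P)⁻¹ * ((1 + P) * ∑ e ∈ Finset.range (n + 1),
              (-1) ^ e * (Nat.multichoose (m + 1) e : PowerSeries ℚ) * P ^ e) := by
            rw [← mul_assoc, h1, one_mul]
        _ = _ := by
            rw [h]
            ring
  obtain ⟨R, hR⟩ := key
  have h := congrArg (PowerSeries.coeff n) hR
  have h0 : PowerSeries.coeff n (P ^ (n + 1) * R) = 0 := by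
    obtain ⟨Q, hQ⟩ := PowerSeries.X_dvd_iff.2 hP
    rw [hQ, mul_pow, mul_assoc, PowerSeries.coeff_X_pow_mul', if_neg (by omega)]
  rw [map_add, h0, add_zero] at h
  rw [← h, map_sum]
  refine Finset.sum_congr rfl fun e _ => ?_
  have : (-1) ^ e * (Nat.multichoose m e : PowerSeries ℚ) * P ^ e =
      PowerSeries.C ((-1) ^ e * (Nat.multichoose m e : ℚ)) * P ^ e := by simp
  rw [this, PowerSeries.coeff_C_mul]

/-! ### The Laurent coefficients as sums over permutations -/

/-- The coefficients of `(1 - z) ^ (-1 / 2)`, with the constant term removed. -/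
noncomputable def invSqrtCoeff (k : ℕ) : ℚ :=
  if k = 0 then 0 else (Nat.centralBinom k : ℚ) / 4 ^ k

theorem invSqrtCoeff_zero : invSqrtCoeff 0 = 0 := if_pos rfl

theorem constantCoeff_logSeries {a : ℕ → ℚ} (ha0 : a 0 = 0) :
    PowerSeries.constantCoeff (logSeries a) = 0 := by
  rw [← PowerSeries.coeff_zero_eq_constantCoeff_apply, logSeries, PowerSeries.coeff_mk, ha0,
    zero_div]

/-- The common form of the numbers `C_{10 n} / 2` (for `r = 3`) and `D_{10 n}` (for `r = 5`). -/
noncomputable def laurentNumber (r n : ℕ) : ℚ :=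
  -((10 * n : ℕ) : ℚ) * ((10 * n - r).factorial : ℚ) *
    PowerSeries.coeff n ((1 + logSeries invSqrtCoeff)⁻¹ ^ (10 * n - r + 1))

/-- The contribution of `e + 1` cycles to `laurentNumber r n`, with a marked cycle of length
`10 x.1 + 1`. -/
noncomputable def cycleTerm (a : ℕ → ℚ) (r n e : ℕ) (x : ℕ × ℕ) : ℚ :=
  ((10 * x.1 : ℕ) : ℚ) * a x.1 *
    (((10 * n + e + 1 - r).factorial : ℚ) / ((10 * x.2 + e).factorial : ℚ) /
      ((10 * x.1 + 1 : ℕ) : ℚ)) * cycleSum a e x.2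

/-- The binomial coefficient of the negative power combines with (10n - r)! to (10n + e + 1 - r)!/(e
+ 1)!, which leaves a divided power; the factor 10n then marks a cycle. The zeroth power contributes
nothing for n ≥ 1, and the shift of e absorbs the leading sign. -/
theorem laurentNumber_eq_sum {r n : ℕ} (hr : r ≤ 5) (hn : 1 ≤ n) :
    laurentNumber r n = ∑ e ∈ Finset.range n, (-1) ^ e *
      ∑ x ∈ Finset.HasAntidiagonal.antidiagonal n, cycleTerm invSqrtCoeff r n e x := by
  rw [laurentNumber, coeff_one_add_inv_pow (constantCoeff_logSeries invSqrtCoeff_zero),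
    Finset.sum_range_succ']
  simp only [pow_zero, PowerSeries.coeff_one, if_neg (show n ≠ 0 by omega), mul_zero, add_zero]
  rw [Finset.mul_sum]
  refine Finset.sum_congr rfl fun e _ => ?_
  have hsum : ∑ x ∈ Finset.HasAntidiagonal.antidiagonal n, cycleTerm invSqrtCoeff r n e x =
      ((10 * n + e + 1 - r).factorial : ℚ) *
        (((10 * n : ℕ) : ℚ) * divPowCoeff invSqrtCoeff (e + 1) n) := by
    rw [ten_mul_divPowCoeff_succ, Finset.mul_sum]
    refine Finset.sum_congr rfl fun x _ => ?_
    rw [cycleTerm, cycleSum]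
    have : ((10 * x.2 + e).factorial : ℚ) ≠ 0 := by positivity
    field_simp
  have hfac : ((10 * n - r).factorial : ℚ) * (Nat.multichoose (10 * n - r + 1) (e + 1) : ℚ) *
      ((e + 1).factorial : ℚ) = ((10 * n + e + 1 - r).factorial : ℚ) := by
    rw [Nat.multichoose_eq, show 10 * n - r + 1 + (e + 1) - 1 = (10 * n - r) + (e + 1) by omega,
      show 10 * n + e + 1 - r = (10 * n - r) + (e + 1) by omega,
      ← Nat.add_choose_mul_factorial_mul_factorial (10 * n - r) (e + 1)]
    push_cast
    ring
  rw [hsum, ← hfac, divPowCoeff]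
  have : ((e + 1).factorial : ℚ) ≠ 0 := by positivity
  field_simp
  ring

/-! ### Primes which are not the length of a cycle -/

theorem cycleTerm_mem {p : ℕ} [Fact p.Prime] {a : ℕ → ℚ} (ha : ∀ k, a k ∈ integralAt p)
    {r n e : ℕ} (hr : r ≤ 5) {x : ℕ × ℕ}
    (hx : x ∈ Finset.HasAntidiagonal.antidiagonal n) (hxp : 10 * x.1 + 1 ≠ p) :
    cycleTerm a r n e x ∈ integralAt p := by
  rw [Finset.HasAntidiagonal.mem_antidiagonal] at hx
  rw [cycleTerm]
  rcases Nat.eq_zero_or_pos x.1 with h0 | h0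
  · rw [h0]
    simp
  have := factorial_div_div_mem (p := p) (k := x.1) (T := 10 * n + e + 1) hr h0 hxp (by omega)
  rw [show 10 * n + e + 1 - (10 * x.1 + 1) = 10 * x.2 + e by omega] at this
  exact Subring.mul_mem _ (Subring.mul_mem _ (Subring.mul_mem _ (natCast_mem _ _) (ha _)) this)
    (cycleSum_mem _ ha _ _)

theorem invSqrtCoeff_mem {p : ℕ} [hp : Fact p.Prime] (hp2 : p ≠ 2) (k : ℕ) :
    invSqrtCoeff k ∈ integralAt p := by
  rw [invSqrtCoeff]
  split_ifs
  · exact Subring.zero_mem _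
  · have h : ¬ p ∣ 4 ^ k := fun h => by
      have h4 := hp.out.dvd_of_dvd_pow h
      rw [show 4 = 2 ^ 2 by norm_num] at h4
      exact hp2 ((Nat.prime_dvd_prime_iff_eq hp.out Nat.prime_two).1 (hp.out.dvd_of_dvd_pow h4))
    rw [div_eq_mul_inv]
    exact Subring.mul_mem _ (natCast_mem _ _) (by simpa using inv_natCast_mem_integralAt h)

theorem laurentNumber_mem_of_forall_ne {p : ℕ} [Fact p.Prime] (hp2 : p ≠ 2) {r n : ℕ}
    (hr : r ≤ 5) (hn : 1 ≤ n) (h : ∀ k, k ≤ n → 10 * k + 1 ≠ p) :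
    laurentNumber r n ∈ integralAt p := by
  rw [laurentNumber_eq_sum hr hn]
  refine Subring.sum_mem _ fun e _ => Subring.mul_mem _
    (Subring.pow_mem _ (Subring.neg_mem _ (Subring.one_mem _)) _) (Subring.sum_mem _ fun x hx => ?_)
  refine cycleTerm_mem (invSqrtCoeff_mem hp2) hr hx (h _ ?_)
  rw [Finset.HasAntidiagonal.mem_antidiagonal] at hx
  omega

theorem four_pow_dvd_factorial {r n : ℕ} (hr : r ≤ 5) (hn : 1 ≤ n) :
    4 ^ n ∣ (10 * n - r).factorial := by
  refine dvd_trans ?_ (Nat.factorial_dvd_factorial (show 10 * n - 5 ≤ 10 * n - r by omega))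
  induction n, hn using Nat.le_induction with
  | base => decide
  | succ n hn ih =>
    rw [pow_succ]
    refine (Nat.mul_dvd_mul ih (show 4 ∣ Nat.factorial 4 by decide)).trans ?_
    refine (Nat.factorial_mul_factorial_dvd_factorial_add (10 * n - 5) 4).trans ?_
    exact Nat.factorial_dvd_factorial (by omega)

/-- The lengths 10k + 1 are odd, so the only powers of 2 in the denominators come from the 4^k in
a_k. Together they divide 4^n, which the factorial absorbs. -/
theorem laurentNumber_mem_two {r n : ℕ} (hr : r ≤ 5) (hn : 1 ≤ n) :
    laurentNumber r n ∈ integralAt 2 := by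
  have hcoeff : ∀ e m, (4 : ℚ) ^ m * PowerSeries.coeff m (logSeries invSqrtCoeff ^ e) ∈
      integralAt 2 := by
    intro e
    induction e with
    | zero =>
      intro m
      rw [pow_zero, PowerSeries.coeff_one]
      split_ifs with h
      · simp [h]
      · simp
    | succ e ih =>
      intro m
      rw [pow_succ', PowerSeries.coeff_mul, Finset.mul_sum]
      refine Subring.sum_mem _ fun x hx => ?_
      rw [Finset.HasAntidiagonal.mem_antidiagonal] at hx
      rw [← hx, pow_add, mul_mul_mul_comm]
      refine Subring.mul_mem _ ?_ (ih _)
      rw [logSeries, PowerSeries.coeff_mk, invSqrtCoeff]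
      split_ifs
      · simp
      · have h4 : (4 : ℚ) ^ x.1 ≠ 0 := by positivity
        have : (4 : ℚ) ^ x.1 * ((Nat.centralBinom x.1 : ℚ) / 4 ^ x.1 / ((10 * x.1 + 1 : ℕ) : ℚ)) =
            (Nat.centralBinom x.1 : ℚ) * ((10 * x.1 + 1 : ℕ) : ℚ)⁻¹ := by
          field_simp
        rw [this]
        exact Subring.mul_mem _ (natCast_mem _ _) (inv_natCast_mem_integralAt (by omega))
  obtain ⟨d, hd⟩ := four_pow_dvd_factorial hr hn
  rw [laurentNumber, coeff_one_add_inv_pow (constantCoeff_logSeries invSqrtCoeff_zero), hd,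
    Finset.mul_sum]
  refine Subring.sum_mem _ fun e _ => ?_
  have : -((10 * n : ℕ) : ℚ) * ((4 ^ n * d : ℕ) : ℚ) * ((-1) ^ e *
      (Nat.multichoose (10 * n - r + 1) e : ℚ) *
        PowerSeries.coeff n (logSeries invSqrtCoeff ^ e)) =
      -((10 * n : ℕ) : ℚ) * (d : ℚ) * ((-1) ^ e * (Nat.multichoose (10 * n - r + 1) e : ℚ)) *
        ((4 : ℚ) ^ n * PowerSeries.coeff n (logSeries invSqrtCoeff ^ e)) := by
    push_cast
    ring
  rw [this]
  exact Subring.mul_mem _ (Subring.mul_mem _ (Subring.mul_mem _ (Subring.neg_mem _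
    (natCast_mem _ _)) (natCast_mem _ _)) (Subring.mul_mem _ (Subring.pow_mem _
      (Subring.neg_mem _ (Subring.one_mem _)) _) (natCast_mem _ _))) (hcoeff _ _)

/-! ### Primes which are the length of a cycle -/

/-- The binomial theorem after splitting off the X^j term; f is the number of cycles of length 10j +
1. -/
theorem divPowCoeff_eq_sum_update (a : ℕ → ℚ) (j e m : ℕ) :
    divPowCoeff a e m = ∑ f ∈ Finset.range (e + 1), if f * j ≤ m then
      (a j / ((10 * j + 1 : ℕ) : ℚ)) ^ f / (f.factorial : ℚ) *
        divPowCoeff (Function.update a j 0) (e - f) (m - f * j) else 0 := by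
  have hlog : logSeries a = PowerSeries.C (a j / ((10 * j + 1 : ℕ) : ℚ)) * PowerSeries.X ^ j +
      logSeries (Function.update a j 0) := by
    ext k
    rw [map_add, PowerSeries.coeff_C_mul, PowerSeries.coeff_X_pow, logSeries, logSeries,
      PowerSeries.coeff_mk, PowerSeries.coeff_mk]
    by_cases hk : k = j
    · subst hk
      simp
    · simp [hk]
  rw [divPowCoeff, hlog, add_pow, map_sum, Finset.sum_div]
  refine Finset.sum_congr rfl fun f hf => ?_
  rw [Finset.mem_range] at hf
  rw [mul_pow, ← map_pow, ← pow_mul, mul_comm j f, mul_assoc, mul_assoc, PowerSeries.coeff_C_mul,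
    PowerSeries.coeff_X_pow_mul']
  split_ifs with h
  · have hch : ((e.choose f : ℕ) : PowerSeries ℚ) = PowerSeries.C (e.choose f : ℚ) := by simp
    rw [hch, mul_comm (_ ^ (e - f)), PowerSeries.coeff_C_mul, divPowCoeff,
      ← Nat.choose_mul_factorial_mul_factorial (show f ≤ e by omega)]
    have h1 : (f.factorial : ℚ) ≠ 0 := by positivity
    have h2 : ((e - f).factorial : ℚ) ≠ 0 := by positivity
    have h3 : (e.choose f : ℚ) ≠ 0 := by
      exact_mod_cast (Nat.choose_pos (show f ≤ e by omega)).ne'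
    push_cast
    field_simp
  · simp

theorem cycleSum_eq_sum_update (a : ℕ → ℚ) (j e m : ℕ) :
    cycleSum a e m = ∑ f ∈ Finset.range (e + 1), if f * j ≤ m then
      ((10 * m + e).factorial : ℚ) / ((f.factorial : ℚ) * ((10 * j + 1 : ℕ) : ℚ) ^ f) /
        ((10 * (m - f * j) + (e - f)).factorial : ℚ) * a j ^ f *
        cycleSum (Function.update a j 0) (e - f) (m - f * j) else 0 := by
  rw [cycleSum, divPowCoeff_eq_sum_update a j, Finset.mul_sum]
  refine Finset.sum_congr rfl fun f _ => ?_
  split_ifs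
  · rw [cycleSum, div_pow]
    have h1 : (f.factorial : ℚ) ≠ 0 := by positivity
    have h2 : ((10 * (m - f * j) + (e - f)).factorial : ℚ) ≠ 0 := by positivity
    have h3 : ((10 * j + 1 : ℕ) : ℚ) ≠ 0 := by positivity
    field_simp
  · simp

/-- The quotient counts the permutations of pf letters that consist of f cycles of length p. -/
theorem factorial_mul_pow_dvd_factorial_mul {p : ℕ} (hp : 0 < p) (f : ℕ) :
    f.factorial * p ^ f ∣ (p * f).factorial := by
  induction f with
  | zero => simp
  | succ f ih =>
    obtain ⟨q, rfl⟩ : ∃ k, p = k + 1 := ⟨p - 1, by omega⟩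
    rw [show (q + 1) * (f + 1) = ((q + 1) * f + q) + 1 by ring, Nat.factorial_succ,
      Nat.factorial_succ, pow_succ,
      show (f + 1) * f.factorial * ((q + 1) ^ f * (q + 1)) =
        ((q + 1) * f + q + 1) * (f.factorial * (q + 1) ^ f) by ring]
    exact Nat.mul_dvd_mul_left _ (ih.trans (Nat.factorial_dvd_factorial (by omega)))

/-- The part of `cycleTerm` all of whose cycles have length `10 j + 1`. -/
noncomputable def mainCycleTerm (a : ℕ → ℚ) (r j e : ℕ) : ℚ :=
  ((10 * j : ℕ) : ℚ) / ((10 * j + 1 : ℕ) : ℚ) * a j ^ (e + 1) *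
    ((((10 * j + 1) * e + (10 * j + 1 - r)).factorial : ℚ) /
      ((e.factorial : ℚ) * ((10 * j + 1 : ℕ) : ℚ) ^ e))

/-- The marked cycle has length p = 10j + 1 and costs one factor p. Sort the others by the number f
of further p-cycles: as soon as letters outside the p-cycles remain, the lost factor is recovered,
either from the permutations of those letters or from the large factorial. -/
theorem cycleTerm_sub_mem {j : ℕ} [hp : Fact (10 * j + 1).Prime] {a : ℕ → ℚ}
    (ha : ∀ k, a k ∈ integralAt (10 * j + 1)) (ha0 : a 0 = 0) {r n : ℕ} (hr : r ≤ 5) (e : ℕ)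
    (hj : j ≤ n) :
    cycleTerm a r n e (j, n - j) - (if n = (e + 1) * j then mainCycleTerm a r j e else 0) ∈
      integralAt (10 * j + 1) := by
  obtain ⟨m, rfl⟩ : ∃ m, n = m + j := ⟨n - j, by omega⟩
  have hj1 : 1 ≤ j := by
    by_contra h
    obtain rfl : j = 0 := by omega
    exact Nat.not_prime_one hp.out
  set p := 10 * j + 1 with hpdef
  have hp0 : (p : ℚ) ≠ 0 := by exact_mod_cast hp.out.ne_zero
  set a' := Function.update a j 0 with ha'
  have ha'mem : ∀ k, a' k ∈ integralAt p := by
    intro k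
    rw [ha']
    by_cases hk : k = j
    · subst hk
      simp
    · simpa [hk] using ha k
  have ha'0 : a' 0 = 0 := by
    rw [ha', Function.update_of_ne (by omega), ha0]
  have ha'p : ∀ k, 10 * k + 1 = p → a' k = 0 := by
    intro k hk
    obtain rfl : k = j := by omega
    simp [ha']
  let t : ℕ → ℚ := fun f => if f * j ≤ m then
      ((10 * m + e + (p - r)).factorial : ℚ) / ((f.factorial : ℚ) * (p : ℚ) ^ f) /
        ((10 * (m - f * j) + (e - f)).factorial : ℚ) * a j ^ f *
        (cycleSum a' (e - f) (m - f * j) / p) else 0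
  have hsum : cycleTerm a r (m + j) e (j, m + j - j) =
      ((10 * j : ℕ) : ℚ) * a j * ∑ f ∈ Finset.range (e + 1), t f := by
    rw [cycleTerm, Nat.add_sub_cancel, cycleSum_eq_sum_update a j, Finset.mul_sum, Finset.mul_sum]
    refine Finset.sum_congr rfl fun f _ => ?_
    simp only [t]
    split_ifs
    · have h1 : (f.factorial : ℚ) ≠ 0 := by positivity
      have h2 : ((10 * (m - f * j) + (e - f)).factorial : ℚ) ≠ 0 := by positivity
      have h3 : ((10 * m + e).factorial : ℚ) ≠ 0 := by positivity
      rw [← hpdef, show 10 * (m + j) + e + 1 - r = 10 * m + e + (p - r) by omega]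
      field_simp
      rw [ha']
    · simp
  have hmem : ∀ f ∈ Finset.range (e + 1), ¬ (f = e ∧ m = e * j) → t f ∈ integralAt p := by
    intro f hf hne
    rw [Finset.mem_range] at hf
    simp only [t]
    split_ifs with hfm
    swap
    · exact Subring.zero_mem _
    obtain ⟨m', rfl⟩ : ∃ m', m = m' + f * j := ⟨m - f * j, by omega⟩
    obtain ⟨e', rfl⟩ : ∃ e', e = e' + f := ⟨e - f, by omega⟩
    rw [Nat.add_sub_cancel, Nat.add_sub_cancel]
    have hT : 10 * (m' + f * j) + (e' + f) = p * f + (10 * m' + e') := by rw [hpdef]; ring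
    rw [hT]
    set T := 10 * m' + e' with hTdef
    have hint : ((p * f + T + (p - r)).factorial : ℚ) / ((f.factorial : ℚ) * (p : ℚ) ^ f) /
        (T.factorial : ℚ) ∈ integralAt p := by
      rw [div_div, ← Nat.cast_pow, ← Nat.cast_mul, ← Nat.cast_mul]
      refine natCast_div_mem_of_dvd _ ?_
      refine (Nat.mul_dvd_mul_right (factorial_mul_pow_dvd_factorial_mul hp.out.pos f) _).trans ?_
      exact (Nat.factorial_mul_factorial_dvd_factorial_add _ _).trans
        (Nat.factorial_dvd_factorial (by omega))
    rcases le_or_gt p T with hpT | hpT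
    -- At least p letters remain outside the p-cycles: their weighted count is divisible by p.
    · exact Subring.mul_mem _ (Subring.mul_mem _ hint (Subring.pow_mem _ (ha _) _))
        (cycleSum_div_mem ha'mem ha'0 ha'p e' m' hpT)
    rcases Nat.eq_zero_or_pos m' with hm' | hm'
    · subst hm'
      have he' : e' ≠ 0 := by
        rintro rfl
        exact hne ⟨by omega, by simp⟩
      obtain ⟨e'', rfl⟩ := Nat.exists_eq_succ_of_ne_zero he'
      rw [Nat.succ_eq_add_one, cycleSum_succ_zero ha'0]
      simp
    -- Here 10 ≤ T < p, so T! is a unit at p, and T ≥ r makes the large factorial a multiple of (p(f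
    -- + 1))!, which yields one more power of p.
    have hrw : ((p * f + T + (p - r)).factorial : ℚ) / ((f.factorial : ℚ) * (p : ℚ) ^ f) /
        (T.factorial : ℚ) * a j ^ f * (cycleSum a' e' m' / p) =
        ((f + 1 : ℕ) : ℚ) * (((p * f + T + (p - r)).factorial : ℚ) /
          (((f + 1).factorial * p ^ (f + 1) : ℕ) : ℚ)) *
        ((T.factorial : ℚ))⁻¹ * a j ^ f * cycleSum a' e' m' := by
      have h1 : (f.factorial : ℚ) ≠ 0 := by positivity
      have h2 : (T.factorial : ℚ) ≠ 0 := by positivity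
      have h3 : (f : ℚ) + 1 ≠ 0 := by positivity
      rw [Nat.factorial_succ]
      push_cast
      field_simp
      ring
    rw [hrw]
    refine Subring.mul_mem _ (Subring.mul_mem _ (Subring.mul_mem _ (Subring.mul_mem _
      (natCast_mem _ _) (natCast_div_mem_of_dvd _ ?_)) (inv_factorial_mem_integralAt hpT))
      (Subring.pow_mem _ (ha _) _)) (cycleSum_mem _ ha'mem _ _)
    refine (factorial_mul_pow_dvd_factorial_mul hp.out.pos (f + 1)).trans (Nat.factorial_dvd_factorial ?_)
    rw [Nat.mul_succ]
    omega
  rw [hsum]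
  have hcond : m + j = (e + 1) * j ↔ m = e * j := by
    rw [Nat.succ_mul]
    omega
  by_cases hm : m = e * j
  · rw [if_pos (hcond.2 hm), Finset.sum_range_succ]
    have hmain : ((10 * j : ℕ) : ℚ) * a j * t e = mainCycleTerm a r j e := by
      simp only [t]
      rw [if_pos hm.ge, hm, Nat.sub_self, Nat.sub_self, cycleSum_zero, if_pos rfl, mainCycleTerm,
        ← hpdef, show 10 * (e * j) + e + (p - r) = p * e + (p - r) by rw [hpdef]; ring_nf]
      simp only [mul_zero, add_zero, Nat.factorial_zero, Nat.cast_one]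
      ring
    rw [mul_add, hmain, add_sub_cancel_right]
    refine Subring.mul_mem _ (Subring.mul_mem _ (natCast_mem _ _) (ha _))
      (Subring.sum_mem _ fun f hf => hmem f ?_ ?_)
    · rw [Finset.mem_range] at hf ⊢
      omega
    · rw [Finset.mem_range] at hf
      omega
  · rw [if_neg (hcond.not.2 hm), sub_zero]
    exact Subring.mul_mem _ (Subring.mul_mem _ (natCast_mem _ _) (ha _))
      (Subring.sum_mem _ fun f hf => hmem f hf fun h => hm h.2)

theorem laurentNumber_sub_mem {j : ℕ} [hp : Fact (10 * j + 1).Prime] {r n : ℕ} (hr : r ≤ 5)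
    (hn : 1 ≤ n) :
    laurentNumber r n - ∑ e ∈ Finset.range n,
      (-1) ^ e * (if n = (e + 1) * j then mainCycleTerm invSqrtCoeff r j e else 0) ∈
      integralAt (10 * j + 1) := by
  have hp2 : 10 * j + 1 ≠ 2 := by omega
  rw [laurentNumber_eq_sum hr hn, ← Finset.sum_sub_distrib]
  refine Subring.sum_mem _ fun e _ => ?_
  rw [← mul_sub]
  refine Subring.mul_mem _ (Subring.pow_mem _ (Subring.neg_mem _ (Subring.one_mem _)) _) ?_
  have hrest : ∀ x ∈ Finset.HasAntidiagonal.antidiagonal n, x.1 ≠ j →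
      cycleTerm invSqrtCoeff r n e x ∈ integralAt (10 * j + 1) := fun x hx hxj =>
    cycleTerm_mem (invSqrtCoeff_mem hp2) hr hx (by omega)
  by_cases hj : j ≤ n
  · have hmem : (j, n - j) ∈ Finset.HasAntidiagonal.antidiagonal n := by
      rw [Finset.HasAntidiagonal.mem_antidiagonal]
      exact Nat.add_sub_cancel' hj
    rw [← Finset.add_sum_erase _ _ hmem, add_sub_right_comm]
    refine Subring.add_mem _ (cycleTerm_sub_mem (invSqrtCoeff_mem hp2) invSqrtCoeff_zero hr e hj)
      (Subring.sum_mem _ fun x hx => ?_)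
    rw [Finset.mem_erase] at hx
    refine hrest x hx.2 fun hxj => hx.1 ?_
    have := hx.2
    rw [Finset.HasAntidiagonal.mem_antidiagonal] at this
    exact Prod.ext hxj (by simp only; omega)
  · have hne : n ≠ (e + 1) * j := by
      rw [Nat.succ_mul]
      omega
    rw [if_neg hne, sub_zero]
    refine Subring.sum_mem _ fun x hx => hrest x hx fun hxj => ?_
    rw [Finset.HasAntidiagonal.mem_antidiagonal] at hx
    omega

theorem laurentNumber_mem_of_not_dvd {j : ℕ} [hp : Fact (10 * j + 1).Prime] {r n : ℕ} (hr : r ≤ 5)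
    (hn : 1 ≤ n) (hjn : ¬ j ∣ n) : laurentNumber r n ∈ integralAt (10 * j + 1) := by
  have h := laurentNumber_sub_mem (j := j) hr hn
  rwa [Finset.sum_eq_zero, sub_zero] at h
  intro e _
  rw [if_neg fun he => hjn (Dvd.intro_left _ he.symm), mul_zero]

theorem laurentNumber_sub_mainCycleTerm_mem {j : ℕ} [hp : Fact (10 * j + 1).Prime] {r e : ℕ}
    (hr : r ≤ 5) :
    laurentNumber r ((e + 1) * j) - (-1) ^ e * mainCycleTerm invSqrtCoeff r j e ∈
      integralAt (10 * j + 1) := by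
  have hj1 : 1 ≤ j := by
    by_contra h
    obtain rfl : j = 0 := by omega
    exact Nat.not_prime_one hp.out
  have h := laurentNumber_sub_mem (j := j) (n := (e + 1) * j) hr (Nat.mul_pos e.succ_pos hj1)
  rwa [Finset.sum_eq_single e, if_pos rfl] at h
  · intro f _ hf
    rw [if_neg, mul_zero]
    intro h
    have := Nat.eq_of_mul_eq_mul_right hj1 h
    omega
  · intro h
    rw [Finset.mem_range] at h
    exact absurd (Nat.le_mul_of_pos_right (e + 1) hj1) (by omega)
/-! ### The residue of the main term -/

/-- The multiples of p contribute f!·p^f. The other factors form f full blocks, each -1 by Wilson,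
and a last block congruent to s!. -/
theorem factorial_mul_add_eq (p : ℕ) [hp : Fact p.Prime] (f : ℕ) :
    ∀ s, s < p → ∃ b : ℕ, (p * f + s).factorial = f.factorial * p ^ f * b ∧
      (b : ZMod p) = (-1) ^ f * (s.factorial : ZMod p) := by
  induction f with
  | zero =>
    intro s _
    exact ⟨s.factorial, by simp, by simp⟩
  | succ f ih =>
    intro s
    induction s with
    | zero =>
      intro _
      obtain ⟨b, hb, hb'⟩ := ih (p - 1) (Nat.sub_lt hp.out.pos one_pos)
      refine ⟨b, ?_, ?_⟩
      · have h : p * (f + 1) + 0 = (p * f + (p - 1)) + 1 := by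
          have := hp.out.pos
          rw [Nat.mul_succ]
          omega
        have h' : p * f + (p - 1) + 1 = p * (f + 1) := by
          rw [← h, add_zero]
        rw [h, Nat.factorial_succ, hb, h', Nat.factorial_succ]
        ring
      · rw [hb', ZMod.wilsons_lemma]
        simp [pow_succ]
    | succ s ihs =>
      intro hs
      obtain ⟨b, hb, hb'⟩ := ihs (by omega)
      refine ⟨(p * (f + 1) + s + 1) * b, ?_, ?_⟩
      · rw [← add_assoc, Nat.factorial_succ, hb]
        ring
      · rw [Nat.cast_mul, hb', Nat.factorial_succ]
        push_cast
        rw [CharP.cast_eq_zero]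
        ring

theorem factorial_sub_three_mul_two {p : ℕ} [hp : Fact p.Prime] (h5 : 5 < p) :
    ((p - 3).factorial : ZMod p) * (Nat.factorial 2 : ZMod p) = -1 := by
  obtain ⟨k, rfl⟩ : ∃ k, p = k + 5 := ⟨p - 5, by omega⟩
  have h := ZMod.wilsons_lemma (k + 5)
  have h0 : ((k + 5 : ℕ) : ZMod (k + 5)) = 0 := CharP.cast_eq_zero _ _
  rw [show k + 5 - 1 = k + 2 + 1 + 1 by omega, Nat.factorial_succ, Nat.factorial_succ] at h
  rw [← h, show k + 5 - 3 = k + 2 by omega]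
  push_cast at h0 ⊢
  have hk : (k : ZMod (k + 5)) = -5 := by linear_combination h0
  rw [hk]
  norm_num [Nat.factorial]
  ring

theorem factorial_sub_five_mul_factorial_four {p : ℕ} [hp : Fact p.Prime] (h5 : 5 < p) :
    ((p - 5).factorial : ZMod p) * (Nat.factorial 4 : ZMod p) = -1 := by
  obtain ⟨k, rfl⟩ : ∃ k, p = k + 5 := ⟨p - 5, by omega⟩
  have h := ZMod.wilsons_lemma (k + 5)
  have h0 : ((k + 5 : ℕ) : ZMod (k + 5)) = 0 := CharP.cast_eq_zero _ _
  rw [show k + 5 - 1 = k + 1 + 1 + 1 + 1 by omega, Nat.factorial_succ, Nat.factorial_succ,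
    Nat.factorial_succ, Nat.factorial_succ] at h
  rw [← h, show k + 5 - 5 = k by omega]
  push_cast at h0 ⊢
  have hk : (k : ZMod (k + 5)) = -5 := by linear_combination h0
  rw [hk]
  norm_num [Nat.factorial]
  ring

theorem centralBinom_mul_factorial (k : ℕ) :
    Nat.centralBinom k * k.factorial = ∏ i ∈ Finset.range k, 2 * (2 * i + 1) := by
  induction k with
  | zero => simp
  | succ k ih =>
    rw [Finset.prod_range_succ, ← ih, Nat.factorial_succ]
    linear_combination k.factorial * Nat.succ_mul_centralBinom_succ k

/-- Modulo p = 10k + 1 one has (p - 1)/2 = 5k ≡ -1/2. So 2(2i + 1) ≡ -4(5k - i), and the products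
for binom(2k, k) and binom(5k, k) agree factor by factor after multiplication by k!, a unit. -/
theorem centralBinom_eq_four_pow_mul_hasseA {k : ℕ} [hp : Fact (10 * k + 1).Prime] :
    (Nat.centralBinom k : ZMod (10 * k + 1)) =
      4 ^ k * ((hasseA (10 * k + 1) : ℤ) : ZMod (10 * k + 1)) := by
  have hk : (k.factorial : ZMod (10 * k + 1)) ≠ 0 := by
    rw [Ne, ZMod.natCast_eq_zero_iff, hp.out.dvd_factorial]
    omega
  refine mul_right_cancel₀ hk ?_
  rw [← Nat.cast_mul, centralBinom_mul_factorial, hasseA,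
    show (10 * k + 1 - 1) / 10 = k by omega, show (10 * k + 1 - 1) / 2 = 5 * k by omega]
  push_cast
  rw [mul_assoc, mul_assoc, ← Nat.cast_mul, mul_comm (Nat.choose _ _),
    ← Nat.descFactorial_eq_factorial_mul_choose, Nat.descFactorial_eq_prod_range, Nat.cast_prod,
    ← mul_assoc, ← mul_pow]
  have hpow : ((4 : ZMod (10 * k + 1)) * -1) ^ k = ∏ _i ∈ Finset.range k, (4 * -1) := by simp
  rw [hpow, ← Finset.prod_mul_distrib]
  refine Finset.prod_congr rfl fun i hi => ?_
  rw [Finset.mem_range] at hi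
  have h0 : ((10 * k + 1 : ℕ) : ZMod (10 * k + 1)) = 0 := CharP.cast_eq_zero _ _
  rw [Nat.cast_sub (by omega)]
  push_cast at h0 ⊢
  linear_combination 2 * h0

theorem intCast_div_mem_of_zmod_eq_zero {p : ℕ} (S : Subring ℚ) {z : ℤ} (hp : p ≠ 0)
    (h : (z : ZMod p) = 0) : (z : ℚ) / p ∈ S := by
  rw [ZMod.intCast_zmod_eq_zero_iff_dvd] at h
  obtain ⟨y, rfl⟩ := h
  have : ((p : ℤ) * y : ℤ) / (p : ℚ) = (y : ℚ) := by
    have : (p : ℚ) ≠ 0 := by exact_mod_cast hp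
    push_cast
    field_simp
  rw [this]
  exact intCast_mem _ _

theorem pow_sub_pow_div_mem (S : Subring ℚ) {a b q : ℚ} (ha : a ∈ S) (hb : b ∈ S)
    (h : (a - b) / q ∈ S) (e : ℕ) : (a ^ e - b ^ e) / q ∈ S := by
  obtain ⟨c, hc⟩ := sub_dvd_pow_sub_pow (⟨a, ha⟩ : S) ⟨b, hb⟩ e
  have hc' : a ^ e - b ^ e = (a - b) * c := by simpa using congrArg Subtype.val hc
  rw [hc', mul_div_right_comm]
  exact S.mul_mem h c.2

theorem invSqrtCoeff_sub_hasseA_div_mem {k : ℕ} [hp : Fact (10 * k + 1).Prime] :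
    (invSqrtCoeff k - hasseA (10 * k + 1)) / ((10 * k + 1 : ℕ) : ℚ) ∈ integralAt (10 * k + 1) := by
  have hk1 : k ≠ 0 := by
    rintro rfl
    exact Nat.not_prime_one hp.out
  have h4 : ((4 ^ k : ℕ) : ℚ)⁻¹ ∈ integralAt (10 * k + 1) := by
    refine inv_natCast_mem_integralAt fun h => ?_
    have := (hp.out.dvd_of_dvd_pow h)
    have := Nat.le_of_dvd (by norm_num) this
    omega
  have hz : (((Nat.centralBinom k : ℤ) - 4 ^ k * hasseA (10 * k + 1) : ℤ) : ZMod (10 * k + 1)) =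
      0 := by
    push_cast
    rw [centralBinom_eq_four_pow_mul_hasseA, sub_self]
  have := (integralAt (10 * k + 1)).mul_mem h4
    (intCast_div_mem_of_zmod_eq_zero (integralAt (10 * k + 1)) hp.out.ne_zero hz)
  convert this using 1
  rw [invSqrtCoeff, if_neg hk1]
  have : (4 : ℚ) ^ k ≠ 0 := by positivity
  push_cast
  field_simp

/-- Only one p is left in the denominator, so the numerator matters modulo p alone. There 10j ≡ -1,
the factorial quotient is (-1)^e (p - r)!, and (r - 1)!(p - r)! ≡ -1; the signs cancel and a_j^(e+1)
≡ A_p^(e+1) remains. -/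
theorem mainCycleTerm_sub_mem {j : ℕ} [hp : Fact (10 * j + 1).Prime] {r e : ℕ} (hr0 : 1 ≤ r)
    (hw : ((10 * j + 1 - r).factorial : ZMod (10 * j + 1)) *
      ((r - 1).factorial : ZMod (10 * j + 1)) = -1) :
    ((r - 1).factorial : ℚ) * ((-1) ^ e * mainCycleTerm invSqrtCoeff r j e) -
      (hasseA (10 * j + 1) : ℚ) ^ (e + 1) / ((10 * j + 1 : ℕ) : ℚ) ∈ integralAt (10 * j + 1) := by
  set p := 10 * j + 1 with hpdef
  have hp2 : p ≠ 2 := by omega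
  obtain ⟨b, hb, hb'⟩ := factorial_mul_add_eq p e (p - r) (Nat.sub_lt hp.out.pos hr0)
  have hp0 : (p : ℚ) ≠ 0 := by exact_mod_cast hp.out.ne_zero
  have hc := invSqrtCoeff_mem hp2 j
  have hmain : mainCycleTerm invSqrtCoeff r j e =
      ((10 * j : ℕ) : ℚ) / (p : ℚ) * invSqrtCoeff j ^ (e + 1) * b := by
    rw [mainCycleTerm, ← hpdef, hb]
    have : (e.factorial : ℚ) ≠ 0 := by positivity
    push_cast
    field_simp
  have hz : ((((r - 1).factorial : ℤ) * (-1) ^ e * (10 * j : ℤ) * b - 1 : ℤ) : ZMod p) = 0 := by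
    have h0 : ((10 * j + 1 : ℕ) : ZMod p) = 0 := CharP.cast_eq_zero _ _
    push_cast at h0 ⊢
    rw [hb']
    have h1 : ((-1 : ZMod p) ^ e) * (-1) ^ e = 1 := by
      rw [← mul_pow]
      simp
    have h10 : (10 * j : ZMod p) = -1 := by linear_combination h0
    rw [h10]
    linear_combination (-((-1 : ZMod p) ^ e * (-1) ^ e)) * hw + h1
  have h1 := (integralAt p).mul_mem ((integralAt p).pow_mem hc (e + 1))
    (intCast_div_mem_of_zmod_eq_zero (integralAt p) hp.out.ne_zero hz)
  have h2 := pow_sub_pow_div_mem (integralAt p) hc (intCast_mem _ (hasseA p))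
    invSqrtCoeff_sub_hasseA_div_mem (e + 1)
  rw [← hpdef] at h2
  convert (integralAt p).add_mem h1 h2 using 1
  rw [hmain, ← hpdef]
  push_cast
  field_simp
  ring

/-! ### The theorem of von Staudt and Clausen for `laurentNumber` -/

theorem mem_clausenPrimes_iff {n p : ℕ} (hn : 1 ≤ n) (hp : p.Prime) :
    p ∈ clausenPrimes (10 * n) ↔ ∃ j e, p = 10 * j + 1 ∧ n = (e + 1) * j := by
  rw [mem_clausenPrimes (by omega)]
  constructor
  · rintro ⟨-, h5, hd⟩
    have hodd : p % 2 = 1 := by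
      rcases hp.eq_two_or_odd with h | h
      · subst h
        exact absurd h5 (by decide)
      · exact h
    have h5' : p % 5 = 1 := h5
    obtain ⟨j, rfl⟩ : ∃ j, p = 10 * j + 1 := ⟨p / 10, by omega⟩
    rw [Nat.add_sub_cancel] at hd
    obtain ⟨e, rfl⟩ := Nat.dvd_of_mul_dvd_mul_left (by norm_num) hd
    have he : e ≠ 0 := by
      rintro rfl
      omega
    exact ⟨j, e - 1, rfl, by rw [Nat.sub_add_cancel (by omega), mul_comm]⟩
  · rintro ⟨j, e, rfl, rfl⟩
    refine ⟨hp, ?_, ?_⟩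
    · change (10 * j + 1) % 5 = 1
      omega
    · rw [Nat.add_sub_cancel]
      exact Nat.mul_dvd_mul_left _ (Dvd.intro_left _ rfl)

theorem laurentNumber_mem_of_notMem {p : ℕ} [hp : Fact p.Prime] {r n : ℕ} (hr : r ≤ 5)
    (hn : 1 ≤ n) (h : p ∉ clausenPrimes (10 * n)) : laurentNumber r n ∈ integralAt p := by
  by_cases hp2 : p = 2
  · subst hp2
    exact laurentNumber_mem_two hr hn
  by_cases hj : ∃ j, p = 10 * j + 1
  · obtain ⟨j, rfl⟩ := hj
    refine laurentNumber_mem_of_not_dvd hr hn fun hd => h ?_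
    rw [mem_clausenPrimes_iff hn hp.out]
    obtain ⟨e, rfl⟩ := hd
    have he : e ≠ 0 := by
      rintro rfl
      omega
    exact ⟨j, e - 1, rfl, by rw [Nat.sub_add_cancel (by omega), mul_comm]⟩
  · exact laurentNumber_mem_of_forall_ne hp2 hr hn fun k _ hk => hj ⟨k, hk.symm⟩

theorem factorial_mul_laurentNumber_sub_mem {p : ℕ} [hp : Fact p.Prime] {r n : ℕ}
    (hr : r = 3 ∨ r = 5) (hn : 1 ≤ n) (h : p ∈ clausenPrimes (10 * n)) :
    ((r - 1).factorial : ℚ) * laurentNumber r n -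
      (hasseA p : ℚ) ^ (10 * n / (p - 1)) / (p : ℚ) ∈ integralAt p := by
  rw [mem_clausenPrimes_iff hn hp.out] at h
  obtain ⟨j, e, rfl, rfl⟩ := h
  have hj1 : 1 ≤ j := by
    by_contra h
    obtain rfl : j = 0 := by omega
    exact Nat.not_prime_one hp.out
  have hdiv : 10 * ((e + 1) * j) / (10 * j + 1 - 1) = e + 1 := by
    rw [Nat.add_sub_cancel, show 10 * ((e + 1) * j) = (e + 1) * (10 * j) by ring]
    exact Nat.mul_div_cancel _ (by omega)
  have hw : ((10 * j + 1 - r).factorial : ZMod (10 * j + 1)) *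
      ((r - 1).factorial : ZMod (10 * j + 1)) = -1 := by
    rcases hr with rfl | rfl
    · exact factorial_sub_three_mul_two (by omega)
    · exact factorial_sub_five_mul_factorial_four (by omega)
  have h1 := laurentNumber_sub_mainCycleTerm_mem (j := j) (r := r) (e := e) (by omega)
  have h2 := mainCycleTerm_sub_mem (j := j) (r := r) (e := e) (by omega) hw
  rw [hdiv]
  convert (integralAt _).add_mem ((integralAt _).mul_mem
    (natCast_mem (integralAt (10 * j + 1)) (r - 1).factorial) h1) h2 using 1
  ring

/-- The polar parts at different primes do not interact: z_l / l is p-integral for l ≠ p. -/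
theorem exists_int_of_forall_sub_mem {m : ℕ} (hm : 1 ≤ m) (q : ℚ) (z : ℕ → ℤ)
    (h1 : ∀ (p : ℕ) [Fact p.Prime], p ∉ clausenPrimes m → q ∈ integralAt p)
    (h2 : ∀ (p : ℕ) [Fact p.Prime], p ∈ clausenPrimes m →
      q - (z p : ℚ) / (p : ℚ) ∈ integralAt p) :
    ∃ G : ℤ, q = ∑ p ∈ clausenPrimes m, (z p : ℚ) / (p : ℚ) + G := by
  suffices h : ∃ G : ℤ, q - ∑ p ∈ clausenPrimes m, (z p : ℚ) / (p : ℚ) = G by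
    obtain ⟨G, hG⟩ := h
    exact ⟨G, by rw [← hG]; ring⟩
  refine exists_int_of_forall_integralAt fun p hp => ?_
  have hother : ∀ l ∈ clausenPrimes m, l ≠ p → (z l : ℚ) / (l : ℚ) ∈ integralAt p := by
    intro l hl hlp
    rw [mem_clausenPrimes hm] at hl
    refine (integralAt p).mul_mem (intCast_mem _ _) (inv_natCast_mem_integralAt fun h => ?_)
    exact hlp ((Nat.prime_dvd_prime_iff_eq hp.out hl.1).1 h).symm
  by_cases hpm : p ∈ clausenPrimes m
  · rw [← Finset.add_sum_erase _ _ hpm, ← sub_sub]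
    refine (integralAt p).sub_mem (h2 p hpm) ((integralAt p).sum_mem fun l hl => ?_)
    rw [Finset.mem_erase] at hl
    exact hother l hl.2 hl.1
  · refine (integralAt p).sub_mem (h1 p hpm) ((integralAt p).sum_mem fun l hl => ?_)
    exact hother l hl fun h => hpm (h ▸ hl)

theorem exists_int_two_mul_laurentNumber_three {n : ℕ} (hn : 1 ≤ n) :
    ∃ G : ℤ, 2 * laurentNumber 3 n =
      ∑ p ∈ clausenPrimes (10 * n), (hasseA p : ℚ) ^ (10 * n / (p - 1)) / (p : ℚ) + G := by
  have := exists_int_of_forall_sub_mem (m := 10 * n) (by omega) (2 * laurentNumber 3 n)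
    (fun p => hasseA p ^ (10 * n / (p - 1)))
    (fun p _ hp => (integralAt p).mul_mem (natCast_mem _ 2)
      (laurentNumber_mem_of_notMem (by norm_num) hn hp))
    (fun p _ hp => by
      simpa [Nat.factorial] using
        factorial_mul_laurentNumber_sub_mem (r := 3) (Or.inl rfl) hn hp)
  simpa using this

theorem exists_int_laurentNumber_five {n : ℕ} (hn : 1 ≤ n) :
    ∃ H : ℤ, laurentNumber 5 n =
      ∑ p ∈ clausenPrimes (10 * n),
        (invFactorialFour p : ℚ) * (hasseA p : ℚ) ^ (10 * n / (p - 1)) / (p : ℚ) + H := by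
  have := exists_int_of_forall_sub_mem (m := 10 * n) (by omega) (laurentNumber 5 n)
    (fun p => invFactorialFour p * hasseA p ^ (10 * n / (p - 1)))
    (fun p _ hp => laurentNumber_mem_of_notMem le_rfl hn hp)
    (fun p hp hpm => by
      have h := factorial_mul_laurentNumber_sub_mem (r := 5) (Or.inr rfl) hn hpm
      have hp5 : 5 < p := by
        obtain ⟨j, e, rfl, -⟩ := (mem_clausenPrimes_iff hn hp.out).1 hpm
        have : j ≠ 0 := by
          rintro rfl
          exact Nat.not_prime_one hp.out
        omega
      have hp24 : ¬ p ∣ Nat.factorial 4 := by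
        rw [hp.out.dvd_factorial]
        omega
      -- The known polar part is that of 4! times the number. Dividing by the unit 4! and replacing
      -- 1/4! by its integer representative changes it by a p-integral amount only.
      have hz : ((1 - Nat.factorial 4 * invFactorialFour p : ℤ) : ZMod p) = 0 := by
        push_cast
        rw [invFactorialFour, ZMod.natCast_zmod_val, mul_inv_cancel₀, sub_self]
        rwa [Ne, ZMod.natCast_eq_zero_iff]
      have h1 := intCast_div_mem_of_zmod_eq_zero (integralAt p) hp.out.ne_zero hz
      have h2 := (integralAt p).mul_mem (inv_natCast_mem_integralAt hp24)
        ((integralAt p).add_mem h ((integralAt p).mul_mem h1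
          (intCast_mem _ (hasseA p ^ (10 * n / (p - 1))))))
      convert h2 using 1
      have hp0 : (p : ℚ) ≠ 0 := by exact_mod_cast hp.out.ne_zero
      have h24 : ((Nat.factorial 4 : ℕ) : ℚ) ≠ 0 := by positivity
      rw [show 5 - 1 = 4 from rfl]
      push_cast
      field_simp
      ring)
  simpa using this
/-! ### Taylor series at the origin as formal power series -/

/-- The Taylor series of `f` at `0`. -/
noncomputable def taylorSeries (f : ℂ → ℂ) : PowerSeries ℂ :=
  PowerSeries.mk fun n => iteratedDeriv n f 0 / (n.factorial : ℂ)

theorem hasSum_taylorSeries {f : ℂ → ℂ} (hf : AnalyticAt ℂ f 0) :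
    ∀ᶠ z in 𝓝 0, HasSum (fun n => PowerSeries.coeff n (taylorSeries f) * z ^ n) (f z) := by
  have := hasFPowerSeriesAt_iff.1 hf.hasFPowerSeriesAt
  simpa [taylorSeries, FormalMultilinearSeries.coeff_ofScalars, mul_comm] using this

theorem hasFPowerSeriesAt_of_hasSum {f : ℂ → ℂ} {A : PowerSeries ℂ}
    (h : ∀ᶠ z in 𝓝 0, HasSum (fun n => PowerSeries.coeff n A * z ^ n) (f z)) :
    HasFPowerSeriesAt f
      (FormalMultilinearSeries.ofScalars ℂ fun n => PowerSeries.coeff n A) 0 := by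
  rw [hasFPowerSeriesAt_iff]
  simpa [FormalMultilinearSeries.coeff_ofScalars, mul_comm] using h

theorem taylorSeries_eq_of_hasSum {f : ℂ → ℂ} {A : PowerSeries ℂ}
    (h : ∀ᶠ z in 𝓝 0, HasSum (fun n => PowerSeries.coeff n A * z ^ n) (f z)) :
    taylorSeries f = A := by
  have h1 := hasFPowerSeriesAt_of_hasSum h
  have h2 := h1.analyticAt.hasFPowerSeriesAt.eq_formalMultilinearSeries h1
  ext n
  have := congrArg (fun q => FormalMultilinearSeries.coeff q n) h2
  simpa [taylorSeries, FormalMultilinearSeries.coeff_ofScalars] using this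

theorem taylorSeries_congr {f g : ℂ → ℂ} (h : f =ᶠ[𝓝 0] g) : taylorSeries f = taylorSeries g := by
  ext n
  rw [taylorSeries, taylorSeries, PowerSeries.coeff_mk, PowerSeries.coeff_mk,
    h.iteratedDeriv_eq n]

theorem constantCoeff_taylorSeries (f : ℂ → ℂ) :
    PowerSeries.constantCoeff (taylorSeries f) = f 0 := by
  rw [← PowerSeries.coeff_zero_eq_constantCoeff_apply]
  simp [taylorSeries]

theorem taylorSeries_const (c : ℂ) : taylorSeries (fun _ => c) = PowerSeries.C c := by
  refine taylorSeries_eq_of_hasSum (Eventually.of_forall fun z => ?_)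
  convert hasSum_single (f := fun n => PowerSeries.coeff n (PowerSeries.C c) * z ^ n) 0 ?_ using 1
  · simp
  · intro n hn
    simp [PowerSeries.coeff_C, hn]

theorem taylorSeries_id : taylorSeries (fun z => z) = PowerSeries.X := by
  refine taylorSeries_eq_of_hasSum (Eventually.of_forall fun z => ?_)
  convert hasSum_single
    (f := fun n => PowerSeries.coeff n (PowerSeries.X : PowerSeries ℂ) * z ^ n) 1 ?_ using 1
  · simp
  · intro n hn
    simp [PowerSeries.coeff_X, hn]

theorem taylorSeries_add {f g : ℂ → ℂ} (hf : AnalyticAt ℂ f 0) (hg : AnalyticAt ℂ g 0) :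
    taylorSeries (fun z => f z + g z) = taylorSeries f + taylorSeries g := by
  refine taylorSeries_eq_of_hasSum ?_
  filter_upwards [hasSum_taylorSeries hf, hasSum_taylorSeries hg] with z h1 h2
  simpa [add_mul] using h1.add h2

theorem taylorSeries_mul {f g : ℂ → ℂ} (hf : AnalyticAt ℂ f 0) (hg : AnalyticAt ℂ g 0) :
    taylorSeries (fun z => f z * g z) = taylorSeries f * taylorSeries g := by
  refine taylorSeries_eq_of_hasSum ?_
  filter_upwards [hasSum_taylorSeries hf, hasSum_taylorSeries hg] with z h1 h2
  have hs1 := h1.summable.norm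
  have hs2 := h2.summable.norm
  have key := (summable_norm_sum_mul_antidiagonal_of_summable_norm hs1 hs2).of_norm.hasSum
  rw [← tsum_mul_tsum_eq_tsum_sum_antidiagonal_of_summable_norm hs1 hs2, h1.tsum_eq,
    h2.tsum_eq] at key
  have heq : (fun n => PowerSeries.coeff n (taylorSeries f * taylorSeries g) * z ^ n) =
      fun n => ∑ x ∈ Finset.HasAntidiagonal.antidiagonal n,
        (PowerSeries.coeff x.1 (taylorSeries f) * z ^ x.1) *
          (PowerSeries.coeff x.2 (taylorSeries g) * z ^ x.2) := by
    funext n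
    rw [PowerSeries.coeff_mul, Finset.sum_mul]
    refine Finset.sum_congr rfl fun x hx => ?_
    rw [Finset.HasAntidiagonal.mem_antidiagonal] at hx
    rw [← hx, pow_add]
    ring
  rw [heq]
  exact key

theorem taylorSeries_pow {f : ℂ → ℂ} (hf : AnalyticAt ℂ f 0) (n : ℕ) :
    taylorSeries (fun z => f z ^ n) = taylorSeries f ^ n := by
  induction n with
  | zero => simpa using taylorSeries_const 1
  | succ n ih =>
    simp_rw [pow_succ]
    rw [taylorSeries_mul (hf.fun_pow n) hf, ih]

theorem taylorSeries_deriv (f : ℂ → ℂ) :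
    taylorSeries (deriv f) = PowerSeries.derivative ℂ (taylorSeries f) := by
  ext n
  rw [PowerSeries.coeff_derivative, taylorSeries, taylorSeries, PowerSeries.coeff_mk,
    PowerSeries.coeff_mk, iteratedDeriv_succ', Nat.factorial_succ]
  have : (n.factorial : ℂ) ≠ 0 := by exact_mod_cast n.factorial_ne_zero
  have : (n : ℂ) + 1 ≠ 0 := by exact_mod_cast n.succ_ne_zero
  push_cast
  field_simp

theorem analyticAt_dslope {f : ℂ → ℂ} (hf : AnalyticAt ℂ f 0) : AnalyticAt ℂ (dslope f 0) 0 := by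
  obtain ⟨p, hp⟩ := hf
  exact ⟨_, hp.has_fpower_series_dslope_fslope⟩

theorem eq_add_mul_dslope (f : ℂ → ℂ) (z : ℂ) : f z = f 0 + z * dslope f 0 z := by
  have := sub_smul_dslope f 0 z
  rw [sub_zero, smul_eq_mul] at this
  rw [this]
  ring

theorem taylorSeries_eq_add_X_mul {f : ℂ → ℂ} (hf : AnalyticAt ℂ f 0) :
    taylorSeries f = PowerSeries.C (f 0) + PowerSeries.X * taylorSeries (dslope f 0) := by
  have hd := analyticAt_dslope hf
  have h : taylorSeries f = taylorSeries (fun z => f 0 + z * dslope f 0 z) :=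
    taylorSeries_congr (Eventually.of_forall (eq_add_mul_dslope f))
  have hid : AnalyticAt ℂ (fun z : ℂ => z) 0 := analyticAt_id
  rw [h, taylorSeries_add analyticAt_const (hid.fun_mul hd), taylorSeries_const,
    taylorSeries_mul hid hd, taylorSeries_id]

/-! ### Lagrange inversion -/

theorem coeff_X_mul_derivative {R : Type*} [CommRing R] (A : PowerSeries R) (m : ℕ) :
    PowerSeries.coeff m (PowerSeries.X * PowerSeries.derivative R A) =
      m * PowerSeries.coeff m A := by
  cases m with
  | zero => simp
  | succ m =>
    rw [PowerSeries.coeff_succ_X_mul, PowerSeries.coeff_derivative]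
    push_cast
    ring

/-- Coefficient form of X·(V^k)' = -k·V^(k+1)·X·G', which follows from V = 1/G. -/
theorem coeff_inv_pow_mul_X_mul_derivative {G V : PowerSeries ℂ} (hV : V * G = 1) (k m : ℕ) :
    (k : ℂ) * PowerSeries.coeff m
      (V ^ (k + 1) * (PowerSeries.X * PowerSeries.derivative ℂ G)) =
      -(m * PowerSeries.coeff m (V ^ k)) := by
  have hV' : PowerSeries.derivative ℂ V = -V ^ 2 * PowerSeries.derivative ℂ G := by
    have h := congrArg (PowerSeries.derivative ℂ) hV
    rw [Derivation.leibniz, smul_eq_mul, smul_eq_mul, Derivation.map_one_eq_zero] at h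
    linear_combination V * h - PowerSeries.derivative ℂ V * hV
  rw [← coeff_X_mul_derivative, Derivation.leibniz_pow, hV', ← PowerSeries.coeff_C_mul, ← map_neg]
  congr 1
  rw [map_natCast, nsmul_eq_mul, smul_eq_mul]
  cases k with
  | zero => simp
  | succ k =>
    rw [Nat.add_sub_cancel]
    ring

/-- For F = X·G this is the residue of F'/F^(N+1), which vanishes for N > 0 because the quotient is
a derivative. -/
theorem coeff_derivative_mul_inv_pow {G V : PowerSeries ℂ} (hV : V * G = 1) (N : ℕ) :
    PowerSeries.coeff N (PowerSeries.derivative ℂ (PowerSeries.X * G) * V ^ (N + 1)) =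
      if N = 0 then 1 else 0 := by
  have hd : PowerSeries.derivative ℂ (PowerSeries.X * G) * V ^ (N + 1) =
      V ^ N + V ^ (N + 1) * (PowerSeries.X * PowerSeries.derivative ℂ G) := by
    rw [Derivation.leibniz, smul_eq_mul, smul_eq_mul, PowerSeries.derivative_X]
    linear_combination V ^ N * hV
  rw [hd, map_add]
  split_ifs with h
  · subst h
    simp
  · have h1 := coeff_inv_pow_mul_X_mul_derivative hV N N
    have hN : (N : ℂ) ≠ 0 := by exact_mod_cast h
    refine mul_left_cancel₀ hN ?_
    rw [mul_add, h1]
    ring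

/-- **Lagrange inversion** for the coefficients of `h` in terms of those of `h ∘ f`. -/
theorem coeff_taylorSeries_eq {f : ℂ → ℂ} (hf : AnalyticAt ℂ f 0) (hf0 : f 0 = 0)
    {G V : PowerSeries ℂ} (hF : taylorSeries f = PowerSeries.X * G) (hV : V * G = 1)
    (N : ℕ) {h : ℂ → ℂ} (hh : AnalyticAt ℂ h 0) :
    PowerSeries.coeff N (taylorSeries h) = PowerSeries.coeff N
      (taylorSeries (fun z => h (f z)) * PowerSeries.derivative ℂ (taylorSeries f) *
        V ^ (N + 1)) := by
  induction N generalizing h with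
  | zero =>
    have h1 := coeff_derivative_mul_inv_pow hV 0
    rw [PowerSeries.coeff_zero_eq_constantCoeff_apply] at h1
    rw [PowerSeries.coeff_zero_eq_constantCoeff_apply,
      PowerSeries.coeff_zero_eq_constantCoeff_apply, mul_assoc, map_mul, hF, h1,
      constantCoeff_taylorSeries, constantCoeff_taylorSeries, hf0]
    simp
  | succ N ih =>
    have hd := analyticAt_dslope hh
    have hdf : AnalyticAt ℂ (fun z => dslope h 0 (f z)) 0 := by
      refine AnalyticAt.fun_comp ?_ hf
      rwa [hf0]
    -- Peel off the constant term, h(w) = h(0) + w·h₁(w). The constant has zero residue, and f·V = X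
    -- lowers N by one for h₁.
    have hcomp : taylorSeries (fun z => h (f z)) = PowerSeries.C (h 0) +
        taylorSeries f * taylorSeries (fun z => dslope h 0 (f z)) := by
      have : taylorSeries (fun z => h (f z)) =
          taylorSeries (fun z => h 0 + f z * dslope h 0 (f z)) :=
        taylorSeries_congr (Eventually.of_forall fun z => eq_add_mul_dslope h (f z))
      rw [this, taylorSeries_add analyticAt_const (hf.fun_mul hdf), taylorSeries_const,
        taylorSeries_mul hf hdf]
    have hsplit : taylorSeries (fun z => h (f z)) * PowerSeries.derivative ℂ (taylorSeries f) *
        V ^ (N + 1 + 1) = PowerSeries.C (h 0) * (PowerSeries.derivative ℂ (PowerSeries.X * G) *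
          V ^ (N + 1 + 1)) + PowerSeries.X * (taylorSeries (fun z => dslope h 0 (f z)) *
          PowerSeries.derivative ℂ (taylorSeries f) * V ^ (N + 1)) := by
      rw [hcomp, hF]
      linear_combination PowerSeries.X * taylorSeries (fun z => dslope h 0 (f z)) *
        PowerSeries.derivative ℂ (PowerSeries.X * G) * V ^ (N + 1) * hV
    rw [hsplit, map_add, PowerSeries.coeff_C_mul, coeff_derivative_mul_inv_pow hV,
      if_neg N.succ_ne_zero, mul_zero, zero_add, PowerSeries.coeff_succ_X_mul, ← ih hd,
      taylorSeries_eq_add_X_mul hh, map_add, PowerSeries.coeff_succ_X_mul, PowerSeries.coeff_C,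
      if_neg N.succ_ne_zero, zero_add]

/-! ### The formal integral of `(1 - X ^ 10) ^ (-1 / 2)` -/

/-- The power series of `(1 - X) ^ (-1 / 2)`. -/
noncomputable def invSqrtSeries : PowerSeries ℂ :=
  PowerSeries.mk fun k => (Nat.centralBinom k : ℂ) / 4 ^ k

theorem constantCoeff_invSqrtSeries : PowerSeries.constantCoeff invSqrtSeries = 1 := by
  rw [← PowerSeries.coeff_zero_eq_constantCoeff_apply]
  simp [invSqrtSeries]

/-- The recursion of the central binomial coefficients is 2(1 - X)S' = S, so S²(1 - X) has
derivative 0. -/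
theorem invSqrtSeries_sq : invSqrtSeries ^ 2 * (1 - PowerSeries.X) = 1 := by
  have hode : PowerSeries.C 2 * PowerSeries.derivative ℂ invSqrtSeries -
      PowerSeries.C 2 * (PowerSeries.X * PowerSeries.derivative ℂ invSqrtSeries) =
      invSqrtSeries := by
    ext n
    rw [map_sub, PowerSeries.coeff_C_mul, PowerSeries.coeff_C_mul, coeff_X_mul_derivative,
      PowerSeries.coeff_derivative, invSqrtSeries, PowerSeries.coeff_mk, PowerSeries.coeff_mk]
    have h : ((n : ℂ) + 1) * (Nat.centralBinom (n + 1) : ℂ) =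
        2 * (2 * n + 1) * (Nat.centralBinom n : ℂ) := by
      exact_mod_cast Nat.succ_mul_centralBinom_succ n
    rw [pow_succ]
    field_simp
    linear_combination 2 * h
  refine PowerSeries.derivative.ext ?_ ?_
  · rw [Derivation.leibniz, Derivation.leibniz_pow, map_sub, Derivation.map_one_eq_zero,
      PowerSeries.derivative_X]
    simp only [smul_eq_mul, nsmul_eq_mul]
    rw [map_ofNat] at hode
    push_cast
    linear_combination invSqrtSeries * hode
  · simp [constantCoeff_invSqrtSeries]

/-- A square root in an integral domain is unique up to sign, and the constant term fixes the sign.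
-/
theorem eq_expand_invSqrtSeries {E : PowerSeries ℂ} (hE : PowerSeries.constantCoeff E = 1)
    (h : E ^ 2 * (1 - PowerSeries.X ^ 10) = 1) :
    E = PowerSeries.expand 10 (by norm_num) invSqrtSeries := by
  set E' := PowerSeries.expand 10 (by norm_num) invSqrtSeries with hE'
  have h' : E' ^ 2 * (1 - PowerSeries.X ^ 10) = 1 := by
    have := congrArg (PowerSeries.expand 10 (by norm_num)) invSqrtSeries_sq
    simpa using this
  have hc' : PowerSeries.constantCoeff E' = 1 := by
    rw [hE', PowerSeries.constantCoeff_expand, constantCoeff_invSqrtSeries]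
  have hprod : (E - E') * ((E + E') * (1 - PowerSeries.X ^ 10)) = 0 := by
    linear_combination h - h'
  have hne : (E + E') * (1 - PowerSeries.X ^ 10) ≠ 0 := by
    intro h0
    have := congrArg PowerSeries.constantCoeff h0
    simp [hE, hc'] at this
  exact sub_eq_zero.1 ((mul_eq_zero.1 hprod).resolve_right hne)

/-- The power series `∑ c k / (10 k + 1) X ^ (10 k)`, where `c k` are the coefficients of
`(1 - X) ^ (-1 / 2)`. -/
noncomputable def integralSeries : PowerSeries ℂ :=
  PowerSeries.expand 10 (by norm_num)
    (PowerSeries.map (algebraMap ℚ ℂ) (1 + logSeries invSqrtCoeff))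

/-- The inverse of `integralSeries`. -/
noncomputable def integralSeriesInv : PowerSeries ℂ :=
  PowerSeries.expand 10 (by norm_num)
    (PowerSeries.map (algebraMap ℚ ℂ) (1 + logSeries invSqrtCoeff)⁻¹)

theorem integralSeriesInv_mul : integralSeriesInv * integralSeries = 1 := by
  rw [integralSeriesInv, integralSeries, ← map_mul, ← map_mul, PowerSeries.inv_mul_cancel]
  · simp
  · simp [constantCoeff_logSeries invSqrtCoeff_zero]

theorem coeff_integralSeriesInv_pow (n m : ℕ) :
    PowerSeries.coeff (10 * n) (integralSeriesInv ^ m) =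
      ((PowerSeries.coeff n ((1 + logSeries invSqrtCoeff)⁻¹ ^ m) : ℚ) : ℂ) := by
  rw [integralSeriesInv, ← map_pow, ← map_pow, PowerSeries.coeff_expand_mul, PowerSeries.coeff_map]
  rfl

theorem derivative_X_mul_integralSeries :
    PowerSeries.derivative ℂ (PowerSeries.X * integralSeries) =
      PowerSeries.expand 10 (by norm_num) invSqrtSeries := by
  ext m
  rw [PowerSeries.coeff_derivative, PowerSeries.coeff_succ_X_mul, integralSeries,
    PowerSeries.coeff_expand, PowerSeries.coeff_expand]
  split_ifs with h
  · obtain ⟨k, rfl⟩ := h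
    rw [Nat.mul_div_cancel_left _ (by norm_num), PowerSeries.coeff_map, invSqrtSeries,
      PowerSeries.coeff_mk, map_add, logSeries, PowerSeries.coeff_mk, PowerSeries.coeff_one,
      invSqrtCoeff]
    have : (10 * (k : ℂ) + 1) ≠ 0 := by exact_mod_cast (10 * k).succ_ne_zero
    split_ifs with hk
    · simp [hk]
    · simp
      field_simp
  · simp

theorem taylorSeries_eq_X_mul_integralSeries {f : ℂ → ℂ} (hf0 : f 0 = 0) (hf1 : deriv f 0 = 1)
    (h : PowerSeries.derivative ℂ (taylorSeries f) ^ 2 * (1 - PowerSeries.X ^ 10) = 1) :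
    taylorSeries f = PowerSeries.X * integralSeries := by
  refine PowerSeries.derivative.ext ?_ ?_
  · rw [derivative_X_mul_integralSeries]
    refine eq_expand_invSqrtSeries ?_ h
    rw [← taylorSeries_deriv, constantCoeff_taylorSeries, hf1]
  · simp [constantCoeff_taylorSeries, hf0]

/-- Let N = 10n, G = `integralSeries`, V = 1/G. The series is V^(N-1)(G + XG') = V^(N-2) +
V^(N-1)XG', whose coefficient is (1 - N/(N - 2)) = -2/(N - 2) times that of V^(N-2). This is the
origin of the factor 2 and of (N - 3)! in place of (N - 2)!. -/
theorem coeff_eq_laurentNumber_three {n : ℕ} (hn : 1 ≤ n) :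
    PowerSeries.coeff (10 * n) (integralSeries ^ 2 *
      PowerSeries.derivative ℂ (PowerSeries.X * integralSeries) *
        integralSeriesInv ^ (10 * n + 1)) * (((10 * n : ℕ) : ℂ) * ((10 * n - 2).factorial : ℂ)) =
      2 * ((laurentNumber 3 n : ℚ) : ℂ) := by
  obtain ⟨k, hk⟩ : ∃ k, 10 * n = k + 3 := ⟨10 * n - 3, by omega⟩
  have hV := integralSeriesInv_mul
  have hpow : integralSeriesInv ^ (k + 2) * integralSeries ^ 2 = integralSeriesInv ^ k := by
    rw [pow_add, mul_assoc, ← mul_pow, hV, one_pow, mul_one]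
  have hsplit : integralSeries ^ 2 *
      PowerSeries.derivative ℂ (PowerSeries.X * integralSeries) * integralSeriesInv ^ (k + 3 + 1) =
      integralSeriesInv ^ (k + 1) +
        integralSeriesInv ^ (k + 1 + 1) *
          (PowerSeries.X * PowerSeries.derivative ℂ integralSeries) := by
    rw [Derivation.leibniz, smul_eq_mul, smul_eq_mul, PowerSeries.derivative_X]
    linear_combination (integralSeriesInv ^ 2 * (integralSeries + PowerSeries.X *
      PowerSeries.derivative ℂ integralSeries)) * hpow + integralSeriesInv ^ (k + 1) * hV
  have h1 := coeff_inv_pow_mul_X_mul_derivative hV (k + 1) (10 * n)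
  have h2 := coeff_integralSeriesInv_pow n (k + 1)
  rw [laurentNumber, show 10 * n - 3 = k by omega, show 10 * n - 2 = k + 1 by omega]
  rw [hk, hsplit, ← hk, map_add, Nat.factorial_succ, h2]
  rw [h2] at h1
  have h3 : ((10 * n : ℕ) : ℂ) = k + 3 := by rw [hk]; push_cast; ring
  rw [h3] at h1 ⊢
  have h4 : ((10 * n : ℕ) : ℚ) = k + 3 := by rw [hk]; push_cast; ring
  rw [h4]
  push_cast at h1 ⊢
  linear_combination ((k : ℂ) + 3) * (k.factorial : ℂ) * h1

/-- Φ stands for √(1 - s^10), the inverse of du₂/ds; it cancels the derivative, and -V^(N-4) is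
left, where N = 10n. -/
theorem coeff_eq_laurentNumber_five {n : ℕ} (hn : 1 ≤ n) {Φ : PowerSeries ℂ}
    (hΦ : Φ * PowerSeries.derivative ℂ (PowerSeries.X * integralSeries) = 1) :
    PowerSeries.coeff (10 * n) (-Φ * integralSeries ^ 5 *
      PowerSeries.derivative ℂ (PowerSeries.X * integralSeries) *
        integralSeriesInv ^ (10 * n + 1)) * (((10 * n : ℕ) : ℂ) * ((10 * n - 5).factorial : ℂ)) =
      ((laurentNumber 5 n : ℚ) : ℂ) := by
  obtain ⟨k, hk⟩ : ∃ k, 10 * n = k + 5 := ⟨10 * n - 5, by omega⟩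
  have hV := integralSeriesInv_mul
  have hpow : integralSeriesInv ^ (k + 5 + 1) * integralSeries ^ 5 =
      integralSeriesInv ^ (k + 1) := by
    rw [show k + 5 + 1 = k + 1 + 5 by ring, pow_add _ (k + 1), mul_assoc, ← mul_pow, hV, one_pow,
      mul_one]
  have hsplit : -Φ * integralSeries ^ 5 *
      PowerSeries.derivative ℂ (PowerSeries.X * integralSeries) * integralSeriesInv ^ (k + 5 + 1) =
      -integralSeriesInv ^ (k + 1) := by
    linear_combination (-integralSeries ^ 5 * integralSeriesInv ^ (k + 5 + 1)) * hΦ - hpow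
  have h2 := coeff_integralSeriesInv_pow n (k + 1)
  rw [laurentNumber, show 10 * n - 5 = k by omega]
  rw [hk, hsplit, ← hk, map_neg, h2]
  push_cast
  ring

theorem coeff_abscissa_eq_zero_of_not_dvd {N : ℕ} (hN : ¬ 10 ∣ N) :
    PowerSeries.coeff N (integralSeries ^ 2 *
      PowerSeries.derivative ℂ (PowerSeries.X * integralSeries) *
        integralSeriesInv ^ (N + 1)) = 0 := by
  rw [derivative_X_mul_integralSeries, integralSeries, integralSeriesInv,
    ← map_pow (PowerSeries.expand 10 _), ← map_pow (PowerSeries.expand 10 _), ← map_mul, ← map_mul]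
  exact PowerSeries.coeff_expand_of_not_dvd 10 _ _ hN

theorem coeff_ordinate_eq_zero_of_not_dvd {N : ℕ} (hN : ¬ 10 ∣ N) {Φ : PowerSeries ℂ}
    (hΦ : Φ * PowerSeries.derivative ℂ (PowerSeries.X * integralSeries) = 1) :
    PowerSeries.coeff N (-Φ * integralSeries ^ 5 *
      PowerSeries.derivative ℂ (PowerSeries.X * integralSeries) *
        integralSeriesInv ^ (N + 1)) = 0 := by
  have : -Φ * integralSeries ^ 5 * PowerSeries.derivative ℂ (PowerSeries.X * integralSeries) *
      integralSeriesInv ^ (N + 1) = -(integralSeries ^ 5 * integralSeriesInv ^ (N + 1)) := by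
    linear_combination (-integralSeries ^ 5 * integralSeriesInv ^ (N + 1)) * hΦ
  rw [this, integralSeries, integralSeriesInv,
    ← map_pow (PowerSeries.expand 10 _), ← map_pow (PowerSeries.expand 10 _), ← map_mul, map_neg,
    PowerSeries.coeff_expand_of_not_dvd 10 _ _ hN, neg_zero]
/-! ### The uniformisation of the curve near infinity -/

/-- The principal branch of `(1 - w) ^ (1 / 2)`. -/
noncomputable def sqrtOneSub (w : ℂ) : ℂ :=
  (1 - w) ^ ((2 : ℕ) : ℂ)⁻¹

theorem sqrtOneSub_sq (w : ℂ) : sqrtOneSub w ^ 2 = 1 - w :=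
  Complex.cpow_nat_inv_pow _ two_ne_zero

theorem sqrtOneSub_zero : sqrtOneSub 0 = 1 := by
  simp [sqrtOneSub]

theorem one_sub_mem_slitPlane {w : ℂ} (hw : ‖w‖ < 1) : 1 - w ∈ Complex.slitPlane := by
  rw [Complex.mem_slitPlane_iff]
  left
  have := (Complex.re_le_norm w).trans_lt hw
  simpa using this

theorem sqrtOneSub_re_pos {w : ℂ} (hw : ‖w‖ < 1) : 0 < (sqrtOneSub w).re := by
  have hs := one_sub_mem_slitPlane hw
  rw [sqrtOneSub, Complex.cpow_def_of_ne_zero (Complex.slitPlane_ne_zero hs), Complex.exp_re]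
  refine mul_pos (Real.exp_pos _) (Real.cos_pos_of_mem_Ioo ?_)
  have h1 := Complex.neg_pi_lt_arg (1 - w)
  have h2 := Complex.arg_le_pi (1 - w)
  have h3 := Complex.mem_slitPlane_iff_arg.1 hs
  have h4 : (1 - w).arg < Real.pi := lt_of_le_of_ne h2 h3.1
  have h5 : (Complex.log (1 - w) * ((2 : ℕ) : ℂ)⁻¹).im = (1 - w).arg / 2 := by
    have : ((2 : ℕ) : ℂ)⁻¹ = ((2⁻¹ : ℝ) : ℂ) := by norm_num
    rw [this, Complex.im_mul_ofReal, Complex.log_im]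
    ring
  rw [h5]
  constructor <;> linarith

theorem sqrtOneSub_ne_zero {w : ℂ} (hw : ‖w‖ < 1) : sqrtOneSub w ≠ 0 := fun h => by
  have := sqrtOneSub_re_pos hw
  rw [h] at this
  exact lt_irrefl _ this

theorem analyticAt_sqrtOneSub {w : ℂ} (hw : ‖w‖ < 1) : AnalyticAt ℂ sqrtOneSub w :=
  (analyticAt_const.sub analyticAt_id).cpow analyticAt_const (one_sub_mem_slitPlane hw)

/-- For z = √(1 - w), |z - 1|·|z + 1| = |w| < 1 and |z + 1| ≥ 1 give |z - 1| ≤ 1. That is |z|² ≤ 2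
Re z, which is the claim for 1/z. -/
theorem half_le_re_inv_sqrtOneSub {w : ℂ} (hw : ‖w‖ < 1) : 1 / 2 ≤ ((sqrtOneSub w)⁻¹).re := by
  set z := sqrtOneSub w with hz
  have hre := sqrtOneSub_re_pos hw
  rw [← hz] at hre
  have h1 : ‖z - 1‖ * ‖z + 1‖ < 1 := by
    rw [← norm_mul, show (z - 1) * (z + 1) = -w by linear_combination sqrtOneSub_sq w, norm_neg]
    exact hw
  have h2 : 1 ≤ ‖z + 1‖ := by
    refine le_trans ?_ (Complex.re_le_norm _)
    simp only [Complex.add_re, Complex.one_re]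
    linarith
  have h3 : ‖z - 1‖ ≤ 1 := by
    by_contra! h
    nlinarith
  have h4 : Complex.normSq (z - 1) ≤ 1 := by
    rw [Complex.normSq_eq_norm_sq]
    nlinarith [norm_nonneg (z - 1)]
  have h5 : 0 < Complex.normSq z := Complex.normSq_pos.2 (sqrtOneSub_ne_zero hw)
  rw [Complex.inv_re, div_le_div_iff₀ two_pos h5]
  rw [Complex.normSq_apply] at h4 ⊢
  simp only [Complex.sub_re, Complex.one_re, Complex.sub_im, Complex.one_im] at h4
  nlinarith

theorem norm_pow_ten_lt_one {s : ℂ} (hs : s ∈ Metric.ball (0 : ℂ) 1) : ‖s ^ 10‖ < 1 := by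
  rw [mem_ball_zero_iff] at hs
  rw [norm_pow]
  exact pow_lt_one₀ (norm_nonneg _) hs (by norm_num)

theorem analyticAt_sqrtOneSub_pow_ten {s : ℂ} (hs : s ∈ Metric.ball (0 : ℂ) 1) :
    AnalyticAt ℂ (fun z => sqrtOneSub (z ^ 10)) s :=
  AnalyticAt.fun_comp (f := fun z : ℂ => z ^ 10)
    (analyticAt_sqrtOneSub (norm_pow_ten_lt_one hs)) (analyticAt_id.fun_pow 10)

theorem exists_primitive (k : ℕ) : ∃ f : ℂ → ℂ, f 0 = 0 ∧
    ∀ z ∈ Metric.ball (0 : ℂ) 1, HasDerivAt f (z ^ k / sqrtOneSub (z ^ 10)) z := by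
  refine (DifferentiableOn.isExactOn_ball fun z hz => ?_).with_val_at 0 0
  have h1 : DifferentiableAt ℂ (fun z : ℂ => z ^ k) z := differentiableAt_pow k
  exact (h1.fun_div (analyticAt_sqrtOneSub_pow_ten hz).differentiableAt
    (sqrtOneSub_ne_zero (norm_pow_ten_lt_one hz))).differentiableWithinAt

/-- The integral `∫ z ^ k / (1 - z ^ 10) ^ (1 / 2) dz` from the origin, on the unit disc. -/
noncomputable def diskIntegral (k : ℕ) : ℂ → ℂ :=
  Classical.choose (exists_primitive k)

theorem diskIntegral_zero (k : ℕ) : diskIntegral k 0 = 0 :=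
  (Classical.choose_spec (exists_primitive k)).1

theorem hasDerivAt_diskIntegral (k : ℕ) {z : ℂ} (hz : z ∈ Metric.ball (0 : ℂ) 1) :
    HasDerivAt (diskIntegral k) (z ^ k / sqrtOneSub (z ^ 10)) z :=
  (Classical.choose_spec (exists_primitive k)).2 z hz

theorem zero_mem_unit_ball : (0 : ℂ) ∈ Metric.ball (0 : ℂ) 1 := Metric.mem_ball_self one_pos

theorem analyticAt_diskIntegral (k : ℕ) : AnalyticAt ℂ (diskIntegral k) 0 := by
  refine DifferentiableOn.analyticAt (s := Metric.ball 0 1) (fun z hz => ?_)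
    (Metric.isOpen_ball.mem_nhds zero_mem_unit_ball)
  exact (hasDerivAt_diskIntegral k hz).differentiableAt.differentiableWithinAt

/-- The derivative of u₂ has real part at least 1/2 on the convex disc; integrate along the segment
and project onto its direction. This gives injectivity of u₂ and control of s by u₂. -/
theorem norm_sub_le_two_mul_norm_diskIntegral_sub {s t : ℂ} (hs : s ∈ Metric.ball (0 : ℂ) 1)
    (ht : t ∈ Metric.ball (0 : ℂ) 1) :
    ‖s - t‖ ≤ 2 * ‖diskIntegral 0 s - diskIntegral 0 t‖ := by
  set d := s - t with hd
  have hmem : ∀ τ ∈ Set.Icc (0 : ℝ) 1, t + τ * d ∈ Metric.ball (0 : ℂ) 1 := by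
    intro τ hτ
    have := (convex_ball (0 : ℂ) 1).add_smul_sub_mem ht hs hτ
    simpa [hd] using this
  have hderiv : ∀ τ ∈ Set.Icc (0 : ℝ) 1, HasDerivAt
      (fun τ : ℝ => (diskIntegral 0 (t + τ * d) * (starRingEnd ℂ) d).re)
      (((sqrtOneSub ((t + τ * d) ^ 10))⁻¹ * d * (starRingEnd ℂ) d).re) τ := by
    intro τ hτ
    have h1 := hasDerivAt_diskIntegral 0 (hmem τ hτ)
    have h2 : HasDerivAt (fun w : ℂ => t + w * d) d (τ : ℂ) := by
      simpa using ((hasDerivAt_id (τ : ℂ)).mul_const d).const_add t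
    have h3 := (h1.comp (τ : ℂ) h2).mul_const ((starRingEnd ℂ) d)
    have h4 := h3.real_of_complex
    simpa using h4
  have hbound : ∀ τ ∈ Set.Icc (0 : ℝ) 1, ‖d‖ ^ 2 / 2 ≤
      ((sqrtOneSub ((t + τ * d) ^ 10))⁻¹ * d * (starRingEnd ℂ) d).re := by
    intro τ hτ
    have h1 := half_le_re_inv_sqrtOneSub (norm_pow_ten_lt_one (hmem τ hτ))
    rw [mul_assoc, Complex.mul_conj, Complex.re_mul_ofReal, Complex.normSq_eq_norm_sq]
    nlinarith [sq_nonneg ‖d‖]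
  have key := (convex_Icc (0 : ℝ) 1).mul_sub_le_image_sub_of_le_deriv
    (fun τ hτ => (hderiv τ hτ).continuousAt.continuousWithinAt)
    (fun τ hτ => (hderiv τ (interior_subset hτ)).differentiableAt.differentiableWithinAt)
    (C := ‖d‖ ^ 2 / 2)
    (fun τ hτ => by
      rw [(hderiv τ (interior_subset hτ)).deriv]
      exact hbound τ (interior_subset hτ))
    0 (by simp) 1 (by simp) zero_le_one
  have hts : t + d = s := by rw [hd]; ring
  simp only [Complex.ofReal_one, one_mul, Complex.ofReal_zero, zero_mul, add_zero, hts] at key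
  rw [← Complex.sub_re, ← sub_mul] at key
  have h5 := key.trans (Complex.re_le_norm _)
  rw [norm_mul, RCLike.norm_conj] at h5
  rcases (norm_nonneg d).eq_or_lt with h0 | h0
  · rw [← h0]
    positivity
  · nlinarith

/-- The point of the curve with parameter `s`. -/
noncomputable def curvePoint (s : ℂ) : ℂ × ℂ :=
  (1 / s ^ 2, -sqrtOneSub (s ^ 10) / s ^ 5)

/-- The local parameter at infinity of a point of the curve. -/
noncomputable def localParam (P : ℂ × ℂ) : ℂ :=
  -(P.1 ^ 2 / P.2) * sqrtOneSub (P.1⁻¹ ^ 5)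

theorem norm_inv_pow_five_lt_one {x : ℂ} (hx : 1 < ‖x‖) : ‖x⁻¹ ^ 5‖ < 1 := by
  rw [norm_pow, norm_inv]
  exact pow_lt_one₀ (by positivity) (inv_lt_one_of_one_lt₀ hx) (by norm_num)

theorem snd_ne_zero_of_mem_quinticCurve {P : ℂ × ℂ} (hP : P ∈ quinticCurve) (hx : 1 < ‖P.1‖) :
    P.2 ≠ 0 := by
  intro h0
  have h1 : P.2 ^ 2 = P.1 ^ 5 - 1 := hP
  have h2 : ‖P.1 ^ 5‖ = 1 := by
    rw [show P.1 ^ 5 = 1 by linear_combination -h1 + P.2 * h0]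
    simp
  rw [norm_pow] at h2
  exact (one_lt_pow₀ hx (by norm_num : 5 ≠ 0)).ne' h2

theorem localParam_sq {P : ℂ × ℂ} (hP : P ∈ quinticCurve) (hx : 1 < ‖P.1‖) :
    localParam P ^ 2 = P.1⁻¹ := by
  have hy := snd_ne_zero_of_mem_quinticCurve hP hx
  have h1 : P.2 ^ 2 = P.1 ^ 5 - 1 := hP
  have hx0 : P.1 ≠ 0 := norm_pos_iff.1 (one_pos.trans hx)
  rw [localParam, mul_pow, sqrtOneSub_sq]
  field_simp
  rw [h1]

/-- x^(-1/2) has no single-valued branch on |x| > 1, but y selects one: y² = x^5(1 - x^(-5)), and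
√(1 - x^(-5)) is single-valued there. -/
theorem localParam_spec {P : ℂ × ℂ} (hP : P ∈ quinticCurve) (hx : 1 < ‖P.1‖) :
    localParam P ∈ Metric.ball (0 : ℂ) 1 ∧ localParam P ≠ 0 ∧ curvePoint (localParam P) = P := by
  have hsq := localParam_sq hP hx
  have hy := snd_ne_zero_of_mem_quinticCurve hP hx
  have hx0 : P.1 ≠ 0 := norm_pos_iff.1 (one_pos.trans hx)
  have hs0 : localParam P ≠ 0 := by
    intro h
    rw [h] at hsq
    exact inv_ne_zero hx0 (by rw [← hsq]; ring)
  have hq0 := sqrtOneSub_ne_zero (norm_inv_pow_five_lt_one hx)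
  refine ⟨?_, hs0, ?_⟩
  · rw [mem_ball_zero_iff]
    have h2 : ‖localParam P‖ ^ 2 < 1 := by
      rw [← norm_pow, hsq, norm_inv]
      exact inv_lt_one_of_one_lt₀ hx
    nlinarith [norm_nonneg (localParam P)]
  · have h10 : localParam P ^ 10 = P.1⁻¹ ^ 5 := by
      rw [← hsq]
      ring
    refine Prod.ext ?_ ?_
    · simp only [curvePoint]
      rw [hsq, one_div, inv_inv]
    · simp only [curvePoint]
      rw [h10, show localParam P ^ 5 = (localParam P ^ 2) ^ 2 * localParam P by ring, hsq,
        localParam]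
      generalize sqrtOneSub (P.1⁻¹ ^ 5) = q at hq0
      field_simp

theorem curvePoint_mem {s : ℂ} (hs0 : s ≠ 0) : curvePoint s ∈ quinticCurve := by
  change (-sqrtOneSub (s ^ 10) / s ^ 5) ^ 2 = (1 / s ^ 2) ^ 5 - 1
  rw [div_pow, neg_sq, sqrtOneSub_sq]
  field_simp

theorem one_lt_norm_curvePoint {s : ℂ} (hs : s ∈ Metric.ball (0 : ℂ) 1) (hs0 : s ≠ 0) :
    1 < ‖(curvePoint s).1‖ := by
  rw [mem_ball_zero_iff] at hs
  have h0 : 0 < ‖s‖ := norm_pos_iff.2 hs0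
  simp only [curvePoint]
  rw [norm_div, norm_one, norm_pow, one_lt_div (by positivity)]
  exact pow_lt_one₀ h0.le hs (by norm_num)

theorem localParam_curvePoint {s : ℂ} (hs : s ∈ Metric.ball (0 : ℂ) 1) (hs0 : s ≠ 0) :
    localParam (curvePoint s) = s := by
  have hq0 := sqrtOneSub_ne_zero (norm_pow_ten_lt_one hs)
  have h : ((1 / s ^ 2)⁻¹) ^ 5 = s ^ 10 := by
    rw [one_div, inv_inv]
    ring
  simp only [localParam, curvePoint]
  rw [h]
  field_simp

/-! ### The integrals along a path -/

theorem differentiableAt_localParam {x y : ℝ → ℂ} {t : ℝ} (hx : DifferentiableAt ℝ x t)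
    (hy : DifferentiableAt ℝ y t) (h : (x t, y t) ∈ quinticCurve) (h1 : 1 < ‖x t‖) :
    DifferentiableAt ℝ (fun t => localParam (x t, y t)) t := by
  have hy0 : y t ≠ 0 := snd_ne_zero_of_mem_quinticCurve h h1
  have hx0 : x t ≠ 0 := norm_pos_iff.1 (one_pos.trans h1)
  have hsq : DifferentiableAt ℝ (fun t => sqrtOneSub ((x t)⁻¹ ^ 5)) t := by
    have h2 : DifferentiableAt ℝ sqrtOneSub ((x t)⁻¹ ^ 5) :=
      (analyticAt_sqrtOneSub (norm_inv_pow_five_lt_one h1)).differentiableAt.restrictScalars ℝ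
    exact DifferentiableAt.fun_comp' t h2 ((hx.fun_inv hx0).fun_pow 5)
  exact (((hx.fun_pow 2).fun_div hy hy0).fun_neg).fun_mul hsq

theorem continuousOn_localParam {x y : ℝ → ℂ} {s : Set ℝ} (hx : ContinuousOn x s)
    (hy : ContinuousOn y s) (h : ∀ t ∈ s, (x t, y t) ∈ quinticCurve) (h1 : ∀ t ∈ s, 1 < ‖x t‖) :
    ContinuousOn (fun t => localParam (x t, y t)) s := by
  have hsq : ContinuousOn (fun t => sqrtOneSub ((x t)⁻¹ ^ 5)) s := by
    intro t ht
    have h2 : ContinuousAt sqrtOneSub ((x t)⁻¹ ^ 5) :=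
      (analyticAt_sqrtOneSub (norm_inv_pow_five_lt_one (h1 t ht))).continuousAt
    have h3 : ContinuousWithinAt (fun t => (x t)⁻¹ ^ 5) s t :=
      ((hx t ht).inv₀ (norm_pos_iff.1 (one_pos.trans (h1 t ht)))).pow 5
    exact ContinuousAt.comp_continuousWithinAt (f := fun t => (x t)⁻¹ ^ 5) h2 h3
  exact (((hx.pow 2).div hy fun t ht => snd_ne_zero_of_mem_quinticCurve (h t ht) (h1 t ht)).neg).mul
    hsq

/-- In the parameter s, x^j dx/(2y) = s^(2-2j) ds/√(1 - s^10), hence the relation between j and k;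
the primitive on the disc removes the dependence on the path. -/
theorem integral_eq_diskIntegral_sub {x y : ℝ → ℂ} {P : ℂ × ℂ} (h : IsPathFromInfinity x y P)
    (j k : ℕ) (hjk : j * 2 + k = 2) {ε : ℝ} (hε : 0 < ε) (hε1 : ε ≤ 1) :
    ∫ t in ε..1, x t ^ j * deriv x t / (2 * y t) =
      diskIntegral k (localParam P) - diskIntegral k (localParam (x ε, y ε)) := by
  have hsub : Set.Icc ε 1 ⊆ Set.Ioc 0 1 := fun t ht => ⟨hε.trans_le ht.1, ht.2⟩
  have hIoo : ∀ t ∈ Set.Ioo ε 1, Set.Ioc (0 : ℝ) 1 ∈ 𝓝 t := fun t ht =>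
    Ioc_mem_nhds (hε.trans ht.1) ht.2
  have hxd : ∀ t ∈ Set.Ioo ε 1, DifferentiableAt ℝ x t := fun t ht =>
    (h.contDiffOn_x.differentiableOn one_ne_zero).differentiableAt (hIoo t ht)
  have hyd : ∀ t ∈ Set.Ioo ε 1, DifferentiableAt ℝ y t := fun t ht =>
    (h.contDiffOn_y.differentiableOn one_ne_zero).differentiableAt (hIoo t ht)
  have hspec : ∀ t ∈ Set.Ioc (0 : ℝ) 1, _ := fun t ht =>
    localParam_spec (h.mem_curve t ht) (h.one_lt_norm t ht)
  have hend : localParam P = localParam (x 1, y 1) := by rw [h.end_at]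
  rw [hend]
  refine intervalIntegral.integral_eq_sub_of_hasDerivAt_of_le
    (f := fun t => diskIntegral k (localParam (x t, y t))) hε1 ?_ ?_ ?_
  · intro t ht
    have h1 := (hasDerivAt_diskIntegral k (hspec t (hsub ht)).1).continuousAt
    have h2 : ContinuousWithinAt (fun t => localParam (x t, y t)) (Set.Icc ε 1) t :=
      continuousOn_localParam (h.contDiffOn_x.continuousOn.mono hsub)
        (h.contDiffOn_y.continuousOn.mono hsub) (fun t ht => h.mem_curve t (hsub ht))
        (fun t ht => h.one_lt_norm t (hsub ht)) t ht
    exact ContinuousAt.comp_continuousWithinAt (f := fun t => localParam (x t, y t)) h1 h2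
  · intro t ht
    have htI := hsub (Set.Ioo_subset_Icc_self ht)
    obtain ⟨hball, hs0, hpt⟩ := hspec t htI
    have hS := (differentiableAt_localParam (hxd t ht) (hyd t ht) (h.mem_curve t htI)
      (h.one_lt_norm t htI)).hasDerivAt
    have hcomp := HasDerivAt.comp t (hasDerivAt_diskIntegral k hball) hS
    -- Differentiating s² = 1/x expresses x' through s', so the derivative of the explicit formula
    -- for s is never computed.
    have hsq : (fun t => localParam (x t, y t) ^ 2) =ᶠ[𝓝 t] fun t => (x t)⁻¹ := by
      filter_upwards [hIoo t ht] with τ hτ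
      exact localParam_sq (h.mem_curve τ hτ) (h.one_lt_norm τ hτ)
    have hx0 : x t ≠ 0 := norm_pos_iff.1 (one_pos.trans (h.one_lt_norm t htI))
    have hd1 := (hS.fun_pow 2).congr_of_eventuallyEq hsq.symm
    have hd2 := (hxd t ht).hasDerivAt.fun_inv hx0
    have hd := hd1.unique hd2
    refine HasDerivAt.congr_deriv hcomp ?_
    set s := localParam (x t, y t) with hs
    set s' := deriv (fun t => localParam (x t, y t)) t with hs'
    have hxs : x t = 1 / s ^ 2 := (congrArg Prod.fst hpt).symm
    have hys : y t = -sqrtOneSub (s ^ 10) / s ^ 5 := (congrArg Prod.snd hpt).symm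
    have hq0 := sqrtOneSub_ne_zero (norm_pow_ten_lt_one hball)
    have hx' : deriv x t = -2 * s' / s ^ 3 := by
      rw [hxs] at hd
      rw [eq_div_iff (pow_ne_zero 3 hs0)]
      refine mul_left_cancel₀ hs0 ?_
      field_simp at hd
      push_cast at hd
      linear_combination hd
    rw [hx', hys, hxs]
    have hj : j ≤ 1 := by omega
    interval_cases j
    · obtain rfl : k = 2 := by omega
      field_simp
    · obtain rfl : k = 0 := by omega
      field_simp
  -- At the end point 1 only the one-sided derivative of x is controlled; it is continuous and
  -- agrees with `deriv x` on the open interval.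
  · have hcont : ContinuousOn
        (fun t => x t ^ j * derivWithin x (Set.Ioc 0 1) t / (2 * y t)) (Set.Icc ε 1) := by
      refine ContinuousOn.div (ContinuousOn.mul ((h.contDiffOn_x.continuousOn.mono hsub).pow j)
        ((h.contDiffOn_x.continuousOn_derivWithin (uniqueDiffOn_Ioc 0 1) le_rfl).mono hsub))
        (continuousOn_const.mul (h.contDiffOn_y.continuousOn.mono hsub)) fun t ht => ?_
      exact mul_ne_zero two_ne_zero (snd_ne_zero_of_mem_quinticCurve
        (h.mem_curve t (hsub ht)) (h.one_lt_norm t (hsub ht)))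
    rw [← Set.uIcc_of_le hε1] at hcont
    refine hcont.intervalIntegrable.congr_uIoo fun t ht => ?_
    rw [Set.uIoo_of_le hε1] at ht
    simp only
    rw [derivWithin_of_mem_nhds (hIoo t ht)]

theorem tendsto_integral_diskIntegral {x y : ℝ → ℂ} {P : ℂ × ℂ} (h : IsPathFromInfinity x y P)
    (j k : ℕ) (hjk : j * 2 + k = 2) :
    Tendsto (fun ε : ℝ => ∫ t in ε..1, x t ^ j * deriv x t / (2 * y t)) (𝓝[>] 0)
      (𝓝 (diskIntegral k (localParam P))) := by
  have hS : Tendsto (fun ε => localParam (x ε, y ε)) (𝓝[>] (0 : ℝ)) (𝓝 0) := by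
    have h1 : Tendsto (fun ε => ‖localParam (x ε, y ε)‖ ^ 2) (𝓝[>] (0 : ℝ)) (𝓝 0) := by
      refine (tendsto_inv_atTop_zero.comp h.start_at_infinity).congr' ?_
      filter_upwards [Ioc_mem_nhdsGT (zero_lt_one' ℝ)] with ε hε
      rw [← norm_pow, localParam_sq (h.mem_curve ε hε) (h.one_lt_norm ε hε), norm_inv,
        Function.comp_apply]
    have h2 := h1.sqrt
    simp only [Real.sqrt_sq (norm_nonneg _), Real.sqrt_zero] at h2
    exact tendsto_zero_iff_norm_tendsto_zero.2 h2
  have hD : Tendsto (fun ε => diskIntegral k (localParam (x ε, y ε))) (𝓝[>] (0 : ℝ)) (𝓝 0) := by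
    have := (analyticAt_diskIntegral k).continuousAt.tendsto.comp hS
    rwa [diskIntegral_zero] at this
  have hsub := (tendsto_const_nhds (x := diskIntegral k (localParam P))).sub hD
  rw [sub_zero] at hsub
  refine hsub.congr' ?_
  filter_upwards [Ioc_mem_nhdsGT (zero_lt_one' ℝ)] with ε hε
  exact (integral_eq_diskIntegral_sub h j k hjk hε.1 hε.2).symm

theorem IsPathFromInfinity.tendsto_integrals {x y : ℝ → ℂ} {P : ℂ × ℂ}
    (h : IsPathFromInfinity x y P) :
    Tendsto (fun ε : ℝ => ∫ t in ε..1, deriv x t / (2 * y t)) (𝓝[>] 0)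
      (𝓝 (diskIntegral 2 (localParam P))) ∧
    Tendsto (fun ε : ℝ => ∫ t in ε..1, x t * deriv x t / (2 * y t)) (𝓝[>] 0)
      (𝓝 (diskIntegral 0 (localParam P))) := by
  constructor
  · simpa using tendsto_integral_diskIntegral h 0 2 rfl
  · simpa using tendsto_integral_diskIntegral h 1 0 rfl

/-- The radius from 0 to s shows that every nonzero parameter in the disc is reached. -/
theorem isPathFromInfinity_curvePoint {s : ℂ} (hs : s ∈ Metric.ball (0 : ℂ) 1) (hs0 : s ≠ 0) :
    IsPathFromInfinity (fun t => (curvePoint (t * s)).1) (fun t => (curvePoint (t * s)).2)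
      (curvePoint s) := by
  have hmem : ∀ t ∈ Set.Ioc (0 : ℝ) 1, (t * s : ℂ) ∈ Metric.ball (0 : ℂ) 1 := by
    intro t ht
    rw [mem_ball_zero_iff] at hs ⊢
    rw [norm_mul, Complex.norm_real, Real.norm_of_nonneg ht.1.le]
    nlinarith [norm_nonneg s, ht.1, ht.2]
  have hne : ∀ t ∈ Set.Ioc (0 : ℝ) 1, (t * s : ℂ) ≠ 0 := fun t ht =>
    mul_ne_zero (Complex.ofReal_ne_zero.2 ht.1.ne') hs0
  have hlin : ContDiff ℝ 1 fun t : ℝ => (t * s : ℂ) :=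
    Complex.ofRealCLM.contDiff.mul contDiff_const
  refine ⟨?_, ?_, fun t ht => curvePoint_mem (hne t ht),
    fun t ht => one_lt_norm_curvePoint (hmem t ht) (hne t ht), ?_, by simp⟩
  · simp only [curvePoint, div_eq_mul_inv]
    exact contDiffOn_const.mul ((hlin.pow 2).contDiffOn.inv fun t ht => pow_ne_zero 2 (hne t ht))
  · simp only [curvePoint, div_eq_mul_inv]
    refine ContDiffOn.mul (ContDiffOn.neg fun t ht => ?_)
      ((hlin.pow 5).contDiffOn.inv fun t ht => pow_ne_zero 5 (hne t ht))
    have h1 : ContDiffAt ℝ 1 (fun z => sqrtOneSub (z ^ 10)) (t * s : ℂ) :=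
      (analyticAt_sqrtOneSub_pow_ten (hmem t ht)).contDiffAt.restrict_scalars ℝ
    exact (ContDiffAt.fun_comp t h1 hlin.contDiffAt).contDiffWithinAt
  · have h1 : Tendsto (fun t : ℝ => (‖s‖ ^ 2 * t ^ 2)⁻¹) (𝓝[>] 0) atTop := by
      refine tendsto_inv_nhdsGT_zero.comp (tendsto_nhdsWithin_iff.2 ⟨?_, ?_⟩)
      · have : Tendsto (fun t : ℝ => ‖s‖ ^ 2 * t ^ 2) (𝓝 0) (𝓝 (‖s‖ ^ 2 * 0 ^ 2)) :=
          (continuous_const.mul (continuous_pow 2)).tendsto 0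
        rw [zero_pow two_ne_zero, mul_zero] at this
        exact this.mono_left nhdsWithin_le_nhds
      · filter_upwards [self_mem_nhdsWithin] with t ht
        have := norm_pos_iff.2 hs0
        have ht' : (0 : ℝ) < t := ht
        exact Set.mem_Ioi.2 (by positivity)
    refine h1.congr fun t => ?_
    simp [curvePoint, mul_pow, mul_comm]

/-! ### The range of the integrals near the origin -/

theorem isAbelianIntegral_iff {P u : ℂ × ℂ} :
    IsAbelianIntegral P u ↔ ∃ s ∈ Metric.ball (0 : ℂ) 1, s ≠ 0 ∧ P = curvePoint s ∧
      u = (diskIntegral 2 s, diskIntegral 0 s) := by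
  constructor
  · rintro ⟨x, y, h, h1, h2⟩
    have h3 := h.tendsto_integrals
    have h01 : (1 : ℝ) ∈ Set.Ioc (0 : ℝ) 1 := ⟨one_pos, le_rfl⟩
    have hP : P ∈ quinticCurve := h.end_at ▸ h.mem_curve 1 h01
    have hP1 : 1 < ‖P.1‖ := by
      rw [← h.end_at]
      exact h.one_lt_norm 1 h01
    obtain ⟨hs, hs0, hpt⟩ := localParam_spec hP hP1
    exact ⟨localParam P, hs, hs0, hpt.symm, Prod.ext (tendsto_nhds_unique h1 h3.1)
      (tendsto_nhds_unique h2 h3.2)⟩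
  · rintro ⟨s, hs, hs0, rfl, rfl⟩
    have h := isPathFromInfinity_curvePoint hs hs0
    have h3 := h.tendsto_integrals
    rw [localParam_curvePoint hs hs0] at h3
    exact ⟨_, _, h, h3⟩

theorem IsAbelianIntegral.unique {P Q u : ℂ × ℂ} (hP : IsAbelianIntegral P u)
    (hQ : IsAbelianIntegral Q u) : P = Q := by
  obtain ⟨s, hs, -, rfl, rfl⟩ := isAbelianIntegral_iff.1 hP
  obtain ⟨t, ht, -, rfl, hu⟩ := isAbelianIntegral_iff.1 hQ
  have h := norm_sub_le_two_mul_norm_diskIntegral_sub hs ht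
  have hu0 : diskIntegral 0 s = diskIntegral 0 t := congrArg Prod.snd hu
  rw [hu0, sub_self, norm_zero, mul_zero] at h
  rw [sub_eq_zero.1 (norm_le_zero_iff.1 h)]

theorem exists_isAbelianInverse : ∃ x y : ℂ × ℂ → ℂ, IsAbelianInverse x y := by
  have h : ∀ u : ℂ × ℂ, ∃ Q : ℂ × ℂ, ∀ P, IsAbelianIntegral P u → Q = P := by
    intro u
    by_cases hu : ∃ Q, IsAbelianIntegral Q u
    · obtain ⟨Q, hQ⟩ := hu
      exact ⟨Q, fun P hP => hQ.unique hP⟩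
    · exact ⟨0, fun P hP => absurd ⟨P, hP⟩ hu⟩
  choose Q hQ using h
  exact ⟨fun u => (Q u).1, fun u => (Q u).2, Eventually.of_forall fun u P hP => hQ u P hP⟩

theorem tendsto_diskIntegral_abelianRange :
    Tendsto (fun s => (diskIntegral 2 s, diskIntegral 0 s)) (𝓝[≠] 0)
      (𝓝[abelianRange] (0, 0)) := by
  refine tendsto_nhdsWithin_iff.2 ⟨?_, ?_⟩
  · have h (k : ℕ) : Tendsto (diskIntegral k) (𝓝 0) (𝓝 0) := by
      have := (analyticAt_diskIntegral k).continuousAt.tendsto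
      rwa [diskIntegral_zero] at this
    exact ((h 2).prodMk_nhds (h 0)).mono_left nhdsWithin_le_nhds
  · filter_upwards [self_mem_nhdsWithin, nhdsWithin_le_nhds
      (Metric.isOpen_ball.mem_nhds zero_mem_unit_ball)] with s hs0 hs
    exact ⟨_, isAbelianIntegral_iff.2 ⟨s, hs, hs0, rfl, rfl⟩⟩

/-- Small s gives small u by continuity; conversely |s| ≤ 2|u₂| on the whole disc, so no values near
(0, 0) come from parameters far from 0. -/
theorem eventually_abelianRange_iff {Q : ℂ × ℂ → Prop} :
    (∀ᶠ u in 𝓝[abelianRange] (0, 0), Q u) ↔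
      ∀ᶠ s in 𝓝[≠] (0 : ℂ), Q (diskIntegral 2 s, diskIntegral 0 s) := by
  refine ⟨fun h => tendsto_diskIntegral_abelianRange.eventually h, fun h => ?_⟩
  rw [eventually_nhdsWithin_iff, Metric.eventually_nhds_iff] at h
  obtain ⟨δ, hδ, h⟩ := h
  rw [eventually_nhdsWithin_iff, Metric.eventually_nhds_iff]
  refine ⟨δ / 2, by positivity, fun u hu hr => ?_⟩
  obtain ⟨P, hP⟩ := hr
  obtain ⟨s, hs, hs0, -, rfl⟩ := isAbelianIntegral_iff.1 hP
  refine h ?_ hs0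
  have h1 := norm_sub_le_two_mul_norm_diskIntegral_sub hs zero_mem_unit_ball
  rw [diskIntegral_zero, sub_zero, sub_zero] at h1
  have h2 : ‖diskIntegral 0 s‖ < δ / 2 := by
    refine lt_of_le_of_lt ?_ hu
    rw [show ((0 : ℂ), (0 : ℂ)) = 0 from rfl, dist_zero_right]
    exact norm_snd_le (diskIntegral 2 s, diskIntegral 0 s)
  rw [dist_zero_right]
  linarith

theorem IsAbelianInverse.eventually_eq {x y : ℂ × ℂ → ℂ} (h : IsAbelianInverse x y) :
    ∀ᶠ s in 𝓝[≠] (0 : ℂ), (x (diskIntegral 2 s, diskIntegral 0 s),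
      y (diskIntegral 2 s, diskIntegral 0 s)) = curvePoint s := by
  filter_upwards [eventually_abelianRange_iff.1 h, self_mem_nhdsWithin, nhdsWithin_le_nhds
    (Metric.isOpen_ball.mem_nhds zero_mem_unit_ball)] with s hs hs0 hsb
  exact hs _ (isAbelianIntegral_iff.2 ⟨s, hsb, hs0, rfl, rfl⟩)
/-! ### Laurent expansions in the variable `u₂` -/

/-- The power series whose nonconstant terms are the normalised Laurent coefficients. -/
noncomputable def laurentSeries (c : ℂ) (d : ℕ) (C : ℕ → ℂ) : PowerSeries ℂ :=
  PowerSeries.mk fun N => if N = 0 then c else if 10 ∣ N then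
    C N / ((N : ℂ) * ((N - d).factorial : ℂ)) else 0

/-- Multiplication by u^d turns the Laurent expansion into a power series with constant term c. The
bound on d makes the subtraction in the exponents exact. -/
theorem hasSum_laurentSeries_iff {c : ℂ} {d : ℕ} (hd : d ≤ 10) {C : ℕ → ℂ} {u v : ℂ}
    (hu : u ≠ 0) :
    HasSum (fun k : ℕ => C (10 * (k + 1)) / ((10 * (k + 1) : ℕ) : ℂ) *
        (u ^ (10 * (k + 1) - d) / (Nat.factorial (10 * (k + 1) - d) : ℂ))) v ↔
      HasSum (fun N => PowerSeries.coeff N (laurentSeries c d C) * u ^ N) (c + u ^ d * v) := by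
  have hinj : Function.Injective fun k : ℕ => 10 * (k + 1) := fun a b h => by
    simp only at h
    omega
  have hud : u ^ d ≠ 0 := pow_ne_zero d hu
  let t : ℕ → ℂ := fun N => if N = 0 then 0 else PowerSeries.coeff N (laurentSeries c d C) * u ^ N
  have hzero : ∀ N ∉ Set.range fun k : ℕ => 10 * (k + 1), t N = 0 := by
    intro N hN
    simp only [t]
    split_ifs with h0
    · rfl
    · rw [laurentSeries, PowerSeries.coeff_mk, if_neg h0, if_neg, zero_mul]
      rintro ⟨k, rfl⟩
      exact hN ⟨k - 1, by simp only; omega⟩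
  have hcomp : t ∘ (fun k : ℕ => 10 * (k + 1)) = fun k : ℕ => u ^ d *
      (C (10 * (k + 1)) / ((10 * (k + 1) : ℕ) : ℂ) *
        (u ^ (10 * (k + 1) - d) / (Nat.factorial (10 * (k + 1) - d) : ℂ))) := by
    funext k
    simp only [t, Function.comp_apply]
    rw [if_neg (by omega), laurentSeries, PowerSeries.coeff_mk, if_neg (by omega),
      if_pos (Dvd.intro _ rfl)]
    have h1 : u ^ (10 * (k + 1)) = u ^ d * u ^ (10 * (k + 1) - d) := by
      rw [← pow_add]
      congr 1
      omega
    rw [h1]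
    have h2 : ((Nat.factorial (10 * (k + 1) - d) : ℕ) : ℂ) ≠ 0 := by
      exact_mod_cast Nat.factorial_ne_zero _
    have h3 : ((10 * (k + 1) : ℕ) : ℂ) ≠ 0 := by
      exact_mod_cast (show 10 * (k + 1) ≠ 0 by omega)
    field_simp
  have hadd : (fun N => PowerSeries.coeff N (laurentSeries c d C) * u ^ N) =
      fun N => (if N = 0 then c else 0) + t N := by
    funext N
    simp only [t]
    split_ifs with h0
    · subst h0
      simp [laurentSeries]
    · simp
  rw [← hasSum_mul_left_iff hud, ← hcomp, hinj.hasSum_iff hzero, hadd]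
  constructor
  · intro h
    exact (hasSum_ite_eq 0 c).add h
  · intro h
    simpa using h.sub (hasSum_ite_eq 0 c)

theorem deriv_diskIntegral_eventuallyEq (k : ℕ) :
    deriv (diskIntegral k) =ᶠ[𝓝 0] fun z => z ^ k / sqrtOneSub (z ^ 10) := by
  filter_upwards [Metric.isOpen_ball.mem_nhds zero_mem_unit_ball] with z hz
  exact (hasDerivAt_diskIntegral k hz).deriv

theorem deriv_diskIntegral_zero : deriv (diskIntegral 0) 0 = 1 := by
  rw [(hasDerivAt_diskIntegral 0 zero_mem_unit_ball).deriv]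
  simp [sqrtOneSub_zero]

theorem taylorSeries_sqrtOneSub_mul :
    taylorSeries (fun z => sqrtOneSub (z ^ 10)) *
      PowerSeries.derivative ℂ (taylorSeries (diskIntegral 0)) = 1 := by
  rw [← taylorSeries_deriv, ← taylorSeries_mul (analyticAt_sqrtOneSub_pow_ten zero_mem_unit_ball)
    (analyticAt_diskIntegral 0).deriv]
  have : (fun z => sqrtOneSub (z ^ 10) * deriv (diskIntegral 0) z) =ᶠ[𝓝 0] fun _ => 1 := by
    filter_upwards [deriv_diskIntegral_eventuallyEq 0,
      Metric.isOpen_ball.mem_nhds zero_mem_unit_ball] with z hz hb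
    rw [hz, pow_zero, mul_one_div_cancel (sqrtOneSub_ne_zero (norm_pow_ten_lt_one hb))]
  rw [taylorSeries_congr this, taylorSeries_const, map_one]

theorem taylorSeries_sqrtOneSub_sq :
    taylorSeries (fun z => sqrtOneSub (z ^ 10)) ^ 2 = 1 - PowerSeries.X ^ 10 := by
  have hid : AnalyticAt ℂ (fun z : ℂ => z) 0 := analyticAt_id
  rw [← taylorSeries_pow (analyticAt_sqrtOneSub_pow_ten zero_mem_unit_ball)]
  have h : (fun z : ℂ => sqrtOneSub (z ^ 10) ^ 2) = fun z => 1 + (-1) * z ^ 10 := by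
    funext z
    rw [sqrtOneSub_sq]
    ring
  rw [h, taylorSeries_add analyticAt_const (analyticAt_const.fun_mul (hid.fun_pow 10)),
    taylorSeries_mul analyticAt_const (hid.fun_pow 10), taylorSeries_pow hid, taylorSeries_id,
    taylorSeries_const, taylorSeries_const]
  simp
  ring

theorem taylorSeries_diskIntegral :
    taylorSeries (diskIntegral 0) = PowerSeries.X * integralSeries := by
  refine taylorSeries_eq_X_mul_integralSeries (diskIntegral_zero 0) deriv_diskIntegral_zero ?_
  rw [← taylorSeries_sqrtOneSub_sq, ← mul_pow, mul_comm, taylorSeries_sqrtOneSub_mul, one_pow]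

theorem taylorSeries_dslope_diskIntegral :
    taylorSeries (dslope (diskIntegral 0) 0) = integralSeries := by
  have h := taylorSeries_eq_add_X_mul (analyticAt_diskIntegral 0)
  rw [diskIntegral_zero, map_zero, zero_add, taylorSeries_diskIntegral] at h
  exact (mul_left_cancel₀ PowerSeries.X_ne_zero h).symm

/-! ### The local inverse of `u₂` and the coefficients of `x` and `y` -/

/-- The local inverse of `u₂` as a function of the local parameter. -/
theorem exists_localInverse_diskIntegral : ∃ g : ℂ → ℂ, AnalyticAt ℂ g 0 ∧ g 0 = 0 ∧
    (∀ᶠ s in 𝓝 0, g (diskIntegral 0 s) = s) ∧ ∀ᶠ u in 𝓝 0, diskIntegral 0 (g u) = u := by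
  have hf := analyticAt_diskIntegral 0
  have hf' : deriv (diskIntegral 0) 0 ≠ 0 := by
    rw [deriv_diskIntegral_zero]
    exact one_ne_zero
  have h1 := hf.analyticAt_localInverse hf'
  have h2 := hf.hasStrictDerivAt.eventually_left_inverse hf'
  have h3 := hf.hasStrictDerivAt.eventually_right_inverse hf'
  rw [diskIntegral_zero] at h1 h3
  refine ⟨_, h1, ?_, h2, h3⟩
  have := h2.self_of_nhds
  rwa [diskIntegral_zero] at this

theorem eventually_punctured_iff {f g : ℂ → ℂ} (hf : ContinuousAt f 0) (hg : ContinuousAt g 0)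
    (hf0 : f 0 = 0) (hg0 : g 0 = 0) (hgf : ∀ᶠ s in 𝓝 0, g (f s) = s)
    (hfg : ∀ᶠ u in 𝓝 0, f (g u) = u) {Q : ℂ → ℂ → Prop} :
    (∀ᶠ s in 𝓝[≠] 0, Q s (f s)) ↔ ∀ᶠ u in 𝓝[≠] 0, Q (g u) u := by
  have aux : ∀ {f g : ℂ → ℂ}, ContinuousAt g 0 → f 0 = 0 → g 0 = 0 →
      (∀ᶠ u in 𝓝 0, f (g u) = u) → Tendsto g (𝓝[≠] 0) (𝓝[≠] 0) := by
    intro f g hg hf0 hg0 hfg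
    refine tendsto_nhdsWithin_iff.2 ⟨?_, ?_⟩
    · have := hg.tendsto
      rw [hg0] at this
      exact this.mono_left nhdsWithin_le_nhds
    · filter_upwards [self_mem_nhdsWithin, nhdsWithin_le_nhds hfg] with u hu h h0
      rw [Set.mem_singleton_iff.1 h0, hf0] at h
      exact hu h.symm
  constructor
  · intro h
    filter_upwards [(aux hg hf0 hg0 hfg).eventually h, nhdsWithin_le_nhds hfg] with u hu hu'
    rwa [hu'] at hu
  · intro h
    filter_upwards [(aux hf hg0 hf0 hgf).eventually h, nhdsWithin_le_nhds hgf] with u hu hu'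
    rwa [hu'] at hu

/-- An analytic function near `0` has the Taylor series `A` if it is the sum of `A` in a punctured
neighbourhood and `A` has the right constant term. -/
theorem taylorSeries_eq_iff_hasSum {h : ℂ → ℂ} (hh : AnalyticAt ℂ h 0) {A : PowerSeries ℂ}
    (hA : PowerSeries.constantCoeff A = h 0) :
    (∀ᶠ u in 𝓝[≠] 0, HasSum (fun N => PowerSeries.coeff N A * u ^ N) (h u)) ↔
      taylorSeries h = A := by
  constructor
  · intro hs
    refine taylorSeries_eq_of_hasSum ?_
    rw [eventually_nhdsWithin_iff] at hs
    filter_upwards [hs] with u hu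
    by_cases hu0 : u = 0
    · subst hu0
      convert hasSum_single (f := fun n => PowerSeries.coeff n A * (0 : ℂ) ^ n) 0 ?_ using 1
      · simp [hA]
      · intro n hn
        simp [hn]
    · exact hu hu0
  · rintro rfl
    exact (hasSum_taylorSeries hh).filter_mono nhdsWithin_le_nhds

/-- The function `u₂ ^ 2 x` of `u₂`, where `g` is the local parameter. -/
noncomputable def abscissa (g : ℂ → ℂ) (u : ℂ) : ℂ :=
  (dslope g 0 u)⁻¹ ^ 2

/-- The function `u₂ ^ 5 y` of `u₂`, where `g` is the local parameter. -/
noncomputable def ordinate (g : ℂ → ℂ) (u : ℂ) : ℂ :=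
  -sqrtOneSub (g u ^ 10) * (dslope g 0 u)⁻¹ ^ 5

/-- This is (s/u₂)·(u₂/s) = 1 away from 0; the identity theorem extends it to s = 0. -/
theorem dslope_mul_dslope_diskIntegral {g : ℂ → ℂ} (hg : AnalyticAt ℂ g 0) (hg0 : g 0 = 0)
    (hgf : ∀ᶠ s in 𝓝 0, g (diskIntegral 0 s) = s) :
    ∀ᶠ s in 𝓝 0, dslope g 0 (diskIntegral 0 s) * dslope (diskIntegral 0) 0 s = 1 := by
  have hf := analyticAt_diskIntegral 0
  have hne : ∀ᶠ s in 𝓝[≠] 0, dslope g 0 (diskIntegral 0 s) * dslope (diskIntegral 0) 0 s = 1 := by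
    filter_upwards [self_mem_nhdsWithin, nhdsWithin_le_nhds hgf] with s hs0 hs
    have h1 := eq_add_mul_dslope g (diskIntegral 0 s)
    have h2 := eq_add_mul_dslope (diskIntegral 0) s
    rw [hs, hg0, zero_add] at h1
    rw [diskIntegral_zero, zero_add] at h2
    refine mul_left_cancel₀ (show s ≠ 0 from hs0) ?_
    nth_rewrite 1 [h2] at h1
    linear_combination -h1
  have hdg : AnalyticAt ℂ (dslope g 0) (diskIntegral 0 0) := by
    rw [diskIntegral_zero]
    exact analyticAt_dslope hg
  have han : AnalyticAt ℂ
      (fun s => dslope g 0 (diskIntegral 0 s) * dslope (diskIntegral 0) 0 s) 0 :=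
    (hdg.fun_comp hf).fun_mul (analyticAt_dslope hf)
  exact (han.frequently_eq_iff_eventually_eq analyticAt_const).1 hne.frequently

theorem dslope_zero_eq_one {g : ℂ → ℂ} (hg : AnalyticAt ℂ g 0) (hg0 : g 0 = 0)
    (hgf : ∀ᶠ s in 𝓝 0, g (diskIntegral 0 s) = s) : dslope g 0 0 = 1 := by
  have := (dslope_mul_dslope_diskIntegral hg hg0 hgf).self_of_nhds
  rwa [diskIntegral_zero, dslope_same (diskIntegral 0), deriv_diskIntegral_zero, mul_one] at this

theorem analyticAt_inv_dslope {g : ℂ → ℂ} (hg : AnalyticAt ℂ g 0) (hg0 : g 0 = 0)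
    (hgf : ∀ᶠ s in 𝓝 0, g (diskIntegral 0 s) = s) :
    AnalyticAt ℂ (fun u => (dslope g 0 u)⁻¹) 0 :=
  (analyticAt_dslope hg).fun_inv (by
    rw [dslope_zero_eq_one hg hg0 hgf]
    exact one_ne_zero)

theorem analyticAt_abscissa {g : ℂ → ℂ} (hg : AnalyticAt ℂ g 0) (hg0 : g 0 = 0)
    (hgf : ∀ᶠ s in 𝓝 0, g (diskIntegral 0 s) = s) : AnalyticAt ℂ (abscissa g) 0 :=
  (analyticAt_inv_dslope hg hg0 hgf).fun_pow 2

theorem analyticAt_ordinate {g : ℂ → ℂ} (hg : AnalyticAt ℂ g 0) (hg0 : g 0 = 0)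
    (hgf : ∀ᶠ s in 𝓝 0, g (diskIntegral 0 s) = s) : AnalyticAt ℂ (ordinate g) 0 := by
  have h1 : AnalyticAt ℂ (fun z => sqrtOneSub (z ^ 10)) (g 0) := by
    rw [hg0]
    exact analyticAt_sqrtOneSub_pow_ten zero_mem_unit_ball
  exact (h1.fun_comp hg).fun_neg.fun_mul ((analyticAt_inv_dslope hg hg0 hgf).fun_pow 5)

theorem coeff_taylorSeries_abscissa {g : ℂ → ℂ} (hg : AnalyticAt ℂ g 0) (hg0 : g 0 = 0)
    (hgf : ∀ᶠ s in 𝓝 0, g (diskIntegral 0 s) = s) (N : ℕ) :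
    PowerSeries.coeff N (taylorSeries (abscissa g)) = PowerSeries.coeff N (integralSeries ^ 2 *
      PowerSeries.derivative ℂ (PowerSeries.X * integralSeries) * integralSeriesInv ^ (N + 1)) := by
  have hf := analyticAt_diskIntegral 0
  rw [coeff_taylorSeries_eq hf (diskIntegral_zero 0) taylorSeries_diskIntegral
    integralSeriesInv_mul N (analyticAt_abscissa hg hg0 hgf), taylorSeries_diskIntegral]
  have : (fun s => abscissa g (diskIntegral 0 s)) =ᶠ[𝓝 0]
      fun s => dslope (diskIntegral 0) 0 s ^ 2 := by
    filter_upwards [dslope_mul_dslope_diskIntegral hg hg0 hgf] with s hs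
    rw [abscissa, inv_eq_of_mul_eq_one_right hs]
  rw [taylorSeries_congr this, taylorSeries_pow (analyticAt_dslope hf),
    taylorSeries_dslope_diskIntegral]

theorem coeff_taylorSeries_ordinate {g : ℂ → ℂ} (hg : AnalyticAt ℂ g 0) (hg0 : g 0 = 0)
    (hgf : ∀ᶠ s in 𝓝 0, g (diskIntegral 0 s) = s) (N : ℕ) :
    PowerSeries.coeff N (taylorSeries (ordinate g)) = PowerSeries.coeff N
      (-taylorSeries (fun z => sqrtOneSub (z ^ 10)) * integralSeries ^ 5 *
      PowerSeries.derivative ℂ (PowerSeries.X * integralSeries) * integralSeriesInv ^ (N + 1)) := by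
  have hf := analyticAt_diskIntegral 0
  have hs := analyticAt_sqrtOneSub_pow_ten zero_mem_unit_ball
  rw [coeff_taylorSeries_eq hf (diskIntegral_zero 0) taylorSeries_diskIntegral
    integralSeriesInv_mul N (analyticAt_ordinate hg hg0 hgf), taylorSeries_diskIntegral]
  have : (fun s => ordinate g (diskIntegral 0 s)) =ᶠ[𝓝 0]
      fun s => (-1 * sqrtOneSub (s ^ 10)) * dslope (diskIntegral 0) 0 s ^ 5 := by
    filter_upwards [dslope_mul_dslope_diskIntegral hg hg0 hgf, hgf] with s hs hs'
    rw [ordinate, inv_eq_of_mul_eq_one_right hs, hs', neg_one_mul]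
  rw [taylorSeries_congr this, taylorSeries_mul (analyticAt_const.fun_mul hs)
    ((analyticAt_dslope hf).fun_pow 5), taylorSeries_mul analyticAt_const hs, taylorSeries_const,
    taylorSeries_pow (analyticAt_dslope hf), taylorSeries_dslope_diskIntegral, map_neg, map_one,
    neg_one_mul]

theorem laurentSeries_of_coeff {c : ℂ} {d : ℕ} {A : PowerSeries ℂ}
    (h0 : PowerSeries.constantCoeff A = c)
    (hA : ∀ N, ¬ 10 ∣ N → PowerSeries.coeff N A = 0) :
    laurentSeries c d (fun N => PowerSeries.coeff N A * ((N : ℂ) * ((N - d).factorial : ℂ))) =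
      A := by
  ext N
  rw [laurentSeries, PowerSeries.coeff_mk]
  split_ifs with h1 h2
  · rw [h1, PowerSeries.coeff_zero_eq_constantCoeff_apply, h0]
  · refine mul_div_cancel_right₀ _ (mul_ne_zero ?_ ?_)
    · exact_mod_cast h1
    · exact_mod_cast Nat.factorial_ne_zero _
  · exact (hA N h2).symm

theorem coeff_laurentSeries_mul {c : ℂ} {d n : ℕ} {C : ℕ → ℂ} (hn : 1 ≤ n) :
    PowerSeries.coeff (10 * n) (laurentSeries c d C) *
      (((10 * n : ℕ) : ℂ) * ((10 * n - d).factorial : ℂ)) = C (10 * n) := by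
  rw [laurentSeries, PowerSeries.coeff_mk, if_neg (by omega), if_pos (Dvd.intro _ rfl)]
  refine div_mul_cancel₀ _ (mul_ne_zero ?_ ?_)
  · exact_mod_cast (show 10 * n ≠ 0 by omega)
  · exact_mod_cast Nat.factorial_ne_zero _

/-- The condition moves from the range of the integrals to small s ≠ 0, then through g to small u₂ ≠
0, where it says that u₂² x and u₂^5 y are sums of the given series. Uniqueness of Taylor series
finishes. -/
theorem areLaurentCoefficients_iff {x y : ℂ × ℂ → ℂ} (hxy : IsAbelianInverse x y) {g : ℂ → ℂ}
    (hg : AnalyticAt ℂ g 0) (hg0 : g 0 = 0) (hgf : ∀ᶠ s in 𝓝 0, g (diskIntegral 0 s) = s)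
    (hfg : ∀ᶠ u in 𝓝 0, diskIntegral 0 (g u) = u) (C D : ℕ → ℂ) :
    AreLaurentCoefficients x y C D ↔ taylorSeries (abscissa g) = laurentSeries 1 2 C ∧
      taylorSeries (ordinate g) = laurentSeries (-1) 5 D := by
  have hf := analyticAt_diskIntegral 0
  have h1 : AreLaurentCoefficients x y C D ↔ ∀ᶠ s in 𝓝[≠] (0 : ℂ), diskIntegral 0 s ≠ 0 ∧
      HasSum (fun N => PowerSeries.coeff N (laurentSeries 1 2 C) * diskIntegral 0 s ^ N)
        (1 + diskIntegral 0 s ^ 2 * (1 / s ^ 2 - 1 / diskIntegral 0 s ^ 2)) ∧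
      HasSum (fun N => PowerSeries.coeff N (laurentSeries (-1) 5 D) * diskIntegral 0 s ^ N)
        (-1 + diskIntegral 0 s ^ 5 *
          (-sqrtOneSub (s ^ 10) / s ^ 5 - (-1) / diskIntegral 0 s ^ 5)) := by
    rw [AreLaurentCoefficients, eventually_abelianRange_iff]
    refine eventually_congr ?_
    filter_upwards [hxy.eventually_eq] with s hs
    have hsx := congrArg Prod.fst hs
    have hsy := congrArg Prod.snd hs
    simp only [curvePoint] at hsx hsy
    rw [hsx, hsy]
    refine and_congr_right fun hu => ?_
    rw [hasSum_laurentSeries_iff (by norm_num) hu, hasSum_laurentSeries_iff (by norm_num) hu]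
  rw [h1, eventually_punctured_iff
    (Q := fun s u => u ≠ 0 ∧
      HasSum (fun N => PowerSeries.coeff N (laurentSeries 1 2 C) * u ^ N)
        (1 + u ^ 2 * (1 / s ^ 2 - 1 / u ^ 2)) ∧
      HasSum (fun N => PowerSeries.coeff N (laurentSeries (-1) 5 D) * u ^ N)
        (-1 + u ^ 5 * (-sqrtOneSub (s ^ 10) / s ^ 5 - (-1) / u ^ 5)))
    hf.continuousAt hg.continuousAt (diskIntegral_zero 0) hg0 hgf hfg]
  have hds := dslope_zero_eq_one hg hg0 hgf
  rw [← taylorSeries_eq_iff_hasSum (analyticAt_abscissa hg hg0 hgf),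
    ← taylorSeries_eq_iff_hasSum (analyticAt_ordinate hg hg0 hgf), ← eventually_and]
  · refine eventually_congr ?_
    filter_upwards [self_mem_nhdsWithin, nhdsWithin_le_nhds hfg] with u hu hfgu
    have hu0 : u ≠ 0 := hu
    have hgu : g u ≠ 0 := by
      intro h
      rw [h, diskIntegral_zero] at hfgu
      exact hu0 hfgu.symm
    have hgd : g u = u * dslope g 0 u := by
      have := eq_add_mul_dslope g u
      rwa [hg0, zero_add] at this
    have hd0 : dslope g 0 u ≠ 0 := right_ne_zero_of_mul (hgd ▸ hgu)
    have e1 : 1 + u ^ 2 * (1 / g u ^ 2 - 1 / u ^ 2) = abscissa g u := by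
      rw [abscissa, hgd]
      field_simp
      ring
    have e2 : -1 + u ^ 5 * (-sqrtOneSub (g u ^ 10) / g u ^ 5 - (-1) / u ^ 5) = ordinate g u := by
      rw [ordinate]
      generalize sqrtOneSub (g u ^ 10) = q
      rw [hgd]
      field_simp
      ring
    rw [e1, e2]
    exact and_iff_right hu0
  · rw [← PowerSeries.coeff_zero_eq_constantCoeff_apply, ordinate, hg0, hds]
    simp [laurentSeries, sqrtOneSub_zero]
  · rw [← PowerSeries.coeff_zero_eq_constantCoeff_apply, abscissa, hds]
    simp [laurentSeries]

theorem theorem2p7 :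
    (∃ x y : ℂ × ℂ → ℂ, IsAbelianInverse x y) ∧
    ∀ x y : ℂ × ℂ → ℂ, IsAbelianInverse x y →
      (∃ C D : ℕ → ℂ, AreLaurentCoefficients x y C D) ∧
      ∀ C D : ℕ → ℂ, AreLaurentCoefficients x y C D →
        ∀ n : ℕ, 1 ≤ n → ∃ G H : ℤ,
          C (10 * n) =
            (∑ p ∈ clausenPrimes (10 * n),
              (hasseA p : ℂ) ^ (10 * n / (p - 1)) / (p : ℂ)) + (G : ℂ) ∧
          D (10 * n) =
            (∑ p ∈ clausenPrimes (10 * n),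
              (invFactorialFour p : ℂ) * (hasseA p : ℂ) ^ (10 * n / (p - 1)) / (p : ℂ)) +
                (H : ℂ) := by
  refine ⟨exists_isAbelianInverse, fun x y hxy => ?_⟩
  obtain ⟨g, hg, hg0, hgf, hfg⟩ := exists_localInverse_diskIntegral
  have hiff := areLaurentCoefficients_iff hxy hg hg0 hgf hfg
  have hds := dslope_zero_eq_one hg hg0 hgf
  have hΦ := taylorSeries_sqrtOneSub_mul
  rw [taylorSeries_diskIntegral] at hΦ
  -- C and D exist as the normalised Taylor coefficients: the constant terms are 1 and -1, and only
  -- exponents divisible by 10 occur.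
  refine ⟨⟨_, _, (hiff _ _).2 ⟨(laurentSeries_of_coeff ?_ fun N hN => ?_).symm,
    (laurentSeries_of_coeff ?_ fun N hN => ?_).symm⟩⟩, fun C D hCD n hn => ?_⟩
  · rw [constantCoeff_taylorSeries, abscissa, hds]
    simp
  · rw [coeff_taylorSeries_abscissa hg hg0 hgf, coeff_abscissa_eq_zero_of_not_dvd hN]
  · rw [constantCoeff_taylorSeries, ordinate, hg0, hds]
    simp [sqrtOneSub_zero]
  · rw [coeff_taylorSeries_ordinate hg hg0 hgf, coeff_ordinate_eq_zero_of_not_dvd hN hΦ]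
  · obtain ⟨hC, hD⟩ := (hiff C D).1 hCD
    obtain ⟨G, hG⟩ := exists_int_two_mul_laurentNumber_three hn
    obtain ⟨H, hH⟩ := exists_int_laurentNumber_five hn
    refine ⟨G, H, ?_, ?_⟩
    · rw [← coeff_laurentSeries_mul (c := 1) (d := 2) (C := C) hn, ← hC,
        coeff_taylorSeries_abscissa hg hg0 hgf, coeff_eq_laurentNumber_three hn]
      have := congrArg (Rat.cast : ℚ → ℂ) hG
      push_cast at this
      exact this
    · rw [← coeff_laurentSeries_mul (c := -1) (d := 5) (C := D) hn, ← hD,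
        coeff_taylorSeries_ordinate hg hg0 hgf, coeff_eq_laurentNumber_five hn hΦ]
      have := congrArg (Rat.cast : ℚ → ℂ) hH
      push_cast at this
      exact this
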